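/- Let $s>0$ and let $\mathcal P=\mathbb R[S_1,S_2,S_3]/(S_1^2+S_2^2+S_3^2-s^2)$ be the space of polynomials on the sphere $S^2$ of radius $s$, with the Poisson bracket $\{f,g\}=\sum_{i,j,k}\epsilon_{ijk}S_i\frac{\partial f}{\partial S_j}\frac{\partial g}{\partial S_k}$. A Poisson subalgebra of $\mathcal P$ is a real linear subspace closed under $\{\,,\}$; let $\mathcal P^1$ be the Poisson subalgebra of polynomials of degree at most one, which is the one generated by $\{1,S_1,S_2,S_3\}$. A quantization of a Poisson subalgebra $\mathcal C\subseteq\mathcal P$ on a complex Hilbert space $H$ is a real-linear map $\mathcal Q$ from $\mathcal C$ to (essentially) self-adjoint operators on $H$, leaving a common dense domain $D\subseteq H$ invariant, such that on $D$ one has $\mathcal Q(\{f,g\})=-\mathrm i[\mathcal Q(f),\mathcal Q(g)]$ for all $f,g\in\mathcal C$, and $\mathcal Q(1)=I$ if $1\in\mathcal C$. For $\mathcal P^1\subseteq\mathcal C$, the quantization $\mathcal Q$ is admissible if it is irreducible on $\mathcal P^1$, i.e. $H\neq0$ and every nonzero linear subspace of $D$ invariant under all $\mathcal Q(f)$, $f\in\mathcal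 P^1$, is dense in $H$. It is nontrivial if $\mathcal Q(S_i)\neq0$ for some $i$. A quantization $\mathcal Q'$ of $\mathcal C'\supseteq\mathcal C$ on the same Hilbert space extends $\mathcal Q$ if its domain $D'$ is contained in the domain $D$ of $\mathcal Q$ and $\mathcal Q'(f)v=\mathcal Q(f)v$ for all $f\in\mathcal C$ and $v\in D'$. Theorem. No nontrivial quantization of $\mathcal P^1$ can be extended to an admissible quantization of a Poisson subalgebra of $\mathcal P$ strictly larger than $\mathcal P^1$. Moreover, $\mathcal P^1$ itself has a nontrivial admissible quantization, and every Poisson subalgebra of $\mathcal P$ that contains $\{1,S_1,S_2,S_3\}$ and has a nontrivial admissible quantization is contained in $\mathcal P^1$; thus $\mathcal P^1$ is the largest Poisson subalgebra of $\mathcal P$ containing $\{1,S_1,S_2,S_3\}$ that admits a nontrivial admissible quantization. -/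

import Mathlib

universe u

/-- The Poisson bracket `{p, q} = ∑ ε_{ijk} S_i (∂p/∂S_j) (∂q/∂S_k)` of polynomials in the three
components `S_1, S_2, S_3` of the spin vector (here `X 0, X 1, X 2`). -/
noncomputable def spinBracket (p q : MvPolynomial (Fin 3) ℝ) : MvPolynomial (Fin 3) ℝ :=
  MvPolynomial.X 0 * (MvPolynomial.pderiv 1 p * MvPolynomial.pderiv 2 q
      - MvPolynomial.pderiv 2 p * MvPolynomial.pderiv 1 q)
    + MvPolynomial.X 1 * (MvPolynomial.pderiv 2 p * MvPolynomial.pderiv 0 q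
      - MvPolynomial.pderiv 0 p * MvPolynomial.pderiv 2 q)
    + MvPolynomial.X 2 * (MvPolynomial.pderiv 0 p * MvPolynomial.pderiv 1 q
      - MvPolynomial.pderiv 1 p * MvPolynomial.pderiv 0 q)

/-- The relation `S_1² + S_2² + S_3² = s²` of the sphere of radius `s`. -/
noncomputable def sphereRelation (s : ℝ) : MvPolynomial (Fin 3) ℝ :=
  MvPolynomial.X 0 ^ 2 + MvPolynomial.X 1 ^ 2 + MvPolynomial.X 2 ^ 2 - MvPolynomial.C (s ^ 2)

/-- The ideal generated by the relation of the sphere of radius `s`. -/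
noncomputable def sphereIdeal (s : ℝ) : Ideal (MvPolynomial (Fin 3) ℝ) :=
  Ideal.span {sphereRelation s}

/-- The space `𝒫` of polynomials in `S_1, S_2, S_3` modulo `S_1² + S_2² + S_3² = s²`.
The commutator bracket of the commutative quotient ring is deliberately not inherited: the
Lie bracket on this type is the Poisson bracket. -/
def SpherePoly (s : ℝ) : Type := MvPolynomial (Fin 3) ℝ ⧸ sphereIdeal s

namespace SpherePoly

noncomputable instance (s : ℝ) : AddCommGroup (SpherePoly s) :=
  inferInstanceAs (AddCommGroup (MvPolynomial (Fin 3) ℝ ⧸ sphereIdeal s))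

noncomputable instance (s : ℝ) : Module ℝ (SpherePoly s) :=
  inferInstanceAs (Module ℝ (MvPolynomial (Fin 3) ℝ ⧸ sphereIdeal s))

/-- The class in `𝒫` of a polynomial. -/
noncomputable def mk (s : ℝ) : MvPolynomial (Fin 3) ℝ →ₗ[ℝ] SpherePoly s :=
  (Ideal.Quotient.mkₐ ℝ (sphereIdeal s)).toLinearMap

theorem mk_surjective (s : ℝ) : Function.Surjective (mk s) :=
  Ideal.Quotient.mkₐ_surjective ℝ (sphereIdeal s)

theorem mk_eq_mk_iff {s : ℝ} {p q : MvPolynomial (Fin 3) ℝ} :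
    mk s p = mk s q ↔ p - q ∈ sphereIdeal s :=
  Ideal.Quotient.eq

/-- The constant function `1`. -/
noncomputable instance (s : ℝ) : One (SpherePoly s) := ⟨mk s 1⟩

/-- The components `S_1, S_2, S_3` of the spin vector. -/
noncomputable def spin (s : ℝ) (i : Fin 3) : SpherePoly s := mk s (MvPolynomial.X i)

theorem spinBracket_mem_left {s : ℝ} {p : MvPolynomial (Fin 3) ℝ} (hp : p ∈ sphereIdeal s)
    (q : MvPolynomial (Fin 3) ℝ) : spinBracket p q ∈ sphereIdeal s := by
  obtain ⟨a, rfl⟩ := Ideal.mem_span_singleton'.1 hp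
  refine Ideal.mem_span_singleton'.2 ⟨spinBracket a q, ?_⟩
  simp [spinBracket, sphereRelation, MvPolynomial.pderiv_X]
  ring

theorem spinBracket_skew (p q : MvPolynomial (Fin 3) ℝ) :
    spinBracket p q = - spinBracket q p := by
  simp only [spinBracket]; ring

theorem spinBracket_add_left (p p' q : MvPolynomial (Fin 3) ℝ) :
    spinBracket (p + p') q = spinBracket p q + spinBracket p' q := by
  simp only [spinBracket, map_add]; ring

theorem spinBracket_add_right (p q q' : MvPolynomial (Fin 3) ℝ) :
    spinBracket p (q + q') = spinBracket p q + spinBracket p q' := by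
  simp only [spinBracket, map_add]; ring

theorem spinBracket_smul_right (t : ℝ) (p q : MvPolynomial (Fin 3) ℝ) :
    spinBracket p (t • q) = t • spinBracket p q := by
  simp only [spinBracket, MvPolynomial.smul_eq_C_mul, MvPolynomial.pderiv_C_mul]; ring

theorem spinBracket_self (p : MvPolynomial (Fin 3) ℝ) : spinBracket p p = 0 := by
  simp only [spinBracket]; ring

theorem pderiv_comm (i j : Fin 3) (p : MvPolynomial (Fin 3) ℝ) :
    MvPolynomial.pderiv i (MvPolynomial.pderiv j p) =
      MvPolynomial.pderiv j (MvPolynomial.pderiv i p) := by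
  have h : ⁅(MvPolynomial.pderiv i : Derivation ℝ (MvPolynomial (Fin 3) ℝ) _),
      (MvPolynomial.pderiv j : Derivation ℝ (MvPolynomial (Fin 3) ℝ) _)⁆ = 0 := by
    refine MvPolynomial.derivation_ext fun k => ?_
    simp only [Derivation.commutator_apply, MvPolynomial.pderiv_X, Pi.single_apply]
    split_ifs <;> simp
  have h' := DFunLike.congr_fun h p
  rw [Derivation.commutator_apply] at h'
  exact sub_eq_zero.1 h'

theorem spinBracket_jacobi (p q r : MvPolynomial (Fin 3) ℝ) :
    spinBracket p (spinBracket q r) =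
      spinBracket (spinBracket p q) r + spinBracket q (spinBracket p r) := by
  simp only [spinBracket, map_add, map_sub, Derivation.leibniz, smul_eq_mul,
    MvPolynomial.pderiv_X, Pi.single_apply, pderiv_comm 1 0, pderiv_comm 2 0, pderiv_comm 2 1]
  simp
  ring

theorem spinBracket_congr {s : ℝ} {p p' q q' : MvPolynomial (Fin 3) ℝ}
    (hp : p - p' ∈ sphereIdeal s) (hq : q - q' ∈ sphereIdeal s) :
    spinBracket p q - spinBracket p' q' ∈ sphereIdeal s := by
  have h : spinBracket p q - spinBracket p' q' =
      spinBracket (p - p') q - spinBracket (q - q') p' := by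
    simp only [spinBracket, map_sub]; ring
  rw [h]
  exact Ideal.sub_mem _ (spinBracket_mem_left hp q) (spinBracket_mem_left hq p')

/-- The Poisson bracket on `𝒫`, the class of `∑ ε_{ijk} S_i (∂f/∂S_j) (∂g/∂S_k)`. -/
noncomputable instance (s : ℝ) : Bracket (SpherePoly s) (SpherePoly s) where
  bracket := Quotient.map₂ spinBracket fun _ _ hp _ _ hq =>
    (Submodule.quotientRel_def _).2 (spinBracket_congr
      ((Submodule.quotientRel_def _).1 hp) ((Submodule.quotientRel_def _).1 hq))

theorem mk_lie_mk (s : ℝ) (p q : MvPolynomial (Fin 3) ℝ) :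
    ⁅mk s p, mk s q⁆ = mk s (spinBracket p q) := rfl

noncomputable instance (s : ℝ) : LieRing (SpherePoly s) where
  add_lie f g h := by
    obtain ⟨p, rfl⟩ := mk_surjective s f
    obtain ⟨q, rfl⟩ := mk_surjective s g
    obtain ⟨r, rfl⟩ := mk_surjective s h
    simp only [← map_add, mk_lie_mk, spinBracket_add_left]
  lie_add f g h := by
    obtain ⟨p, rfl⟩ := mk_surjective s f
    obtain ⟨q, rfl⟩ := mk_surjective s g
    obtain ⟨r, rfl⟩ := mk_surjective s h
    simp only [← map_add, mk_lie_mk, spinBracket_add_right]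
  lie_self f := by
    obtain ⟨p, rfl⟩ := mk_surjective s f
    simp only [mk_lie_mk, spinBracket_self, map_zero]
  leibniz_lie f g h := by
    obtain ⟨p, rfl⟩ := mk_surjective s f
    obtain ⟨q, rfl⟩ := mk_surjective s g
    obtain ⟨r, rfl⟩ := mk_surjective s h
    simp only [← map_add, mk_lie_mk]
    rw [spinBracket_jacobi]

noncomputable instance (s : ℝ) : LieAlgebra ℝ (SpherePoly s) where
  lie_smul t f g := by
    obtain ⟨p, rfl⟩ := mk_surjective s f
    obtain ⟨q, rfl⟩ := mk_surjective s g
    simp only [← map_smul, mk_lie_mk, spinBracket_smul_right]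

/-- The subspace `𝒫ᵏ` of those classes that have a representative of degree at most `k`. -/
noncomputable def degreeLE (s : ℝ) (k : ℕ) : Submodule ℝ (SpherePoly s) :=
  (MvPolynomial.restrictTotalDegree (Fin 3) ℝ k).map (mk s)

theorem totalDegree_pderiv_le {p : MvPolynomial (Fin 3) ℝ} {n : ℕ} (hp : p.totalDegree ≤ n + 1)
    (i : Fin 3) : (MvPolynomial.pderiv i p).totalDegree ≤ n := by
  rw [p.as_sum, map_sum]
  refine MvPolynomial.totalDegree_finsetSum_le fun m hm => ?_
  rw [MvPolynomial.pderiv_monomial]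
  by_cases hi : m i = 0
  · simp [hi]
  refine (MvPolynomial.totalDegree_monomial_le _ _).trans ?_
  have h1 : m.degree ≤ n + 1 := (MvPolynomial.le_totalDegree hm).trans hp
  have h2 : m - Finsupp.single i 1 + Finsupp.single i 1 = m :=
    tsub_add_cancel_of_le (by simpa [Nat.one_le_iff_ne_zero] using hi)
  have h3 := congrArg Finsupp.degree h2
  rw [map_add, Finsupp.degree_single] at h3
  change (m - Finsupp.single i 1).degree ≤ n
  omega

theorem spinBracket_mem_of_mem_one {p q : MvPolynomial (Fin 3) ℝ}
    (hp : p ∈ MvPolynomial.restrictTotalDegree (Fin 3) ℝ 1)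
    (hq : q ∈ MvPolynomial.restrictTotalDegree (Fin 3) ℝ 1) :
    spinBracket p q ∈ MvPolynomial.restrictTotalDegree (Fin 3) ℝ 1 := by
  rw [MvPolynomial.mem_restrictTotalDegree] at hp hq ⊢
  have hterm : ∀ i j k : Fin 3, (MvPolynomial.X i * (MvPolynomial.pderiv j p *
      MvPolynomial.pderiv k q - MvPolynomial.pderiv k p * MvPolynomial.pderiv j q)).totalDegree
        ≤ 1 := by
    intro i j k
    have hmul : ∀ a b : Fin 3,
        (MvPolynomial.pderiv a p * MvPolynomial.pderiv b q).totalDegree ≤ 0 := fun a b =>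
      (MvPolynomial.totalDegree_mul _ _).trans
        (add_le_add (totalDegree_pderiv_le hp a) (totalDegree_pderiv_le hq b))
    refine (MvPolynomial.totalDegree_mul _ _).trans ?_
    rw [MvPolynomial.totalDegree_X]
    exact Nat.add_le_add_left ((MvPolynomial.totalDegree_sub _ _).trans
      (max_le (hmul j k) (hmul k j))) 1
  exact (MvPolynomial.totalDegree_add _ _).trans (max_le ((MvPolynomial.totalDegree_add _ _).trans
    (max_le (hterm 0 1 2) (hterm 1 2 0))) (hterm 2 0 1))

/-- The Poisson subalgebra `𝒫¹` of classes of degree at most one. As everywhere here, a Poisson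
subalgebra is a real subspace closed under the Poisson bracket. -/
noncomputable def P1 (s : ℝ) : LieSubalgebra ℝ (SpherePoly s) where
  __ := degreeLE s 1
  lie_mem' := by
    rintro _ _ ⟨p, hp, rfl⟩ ⟨q, hq, rfl⟩
    exact ⟨_, spinBracket_mem_of_mem_one hp hq, rfl⟩

end SpherePoly

/-- An operator `T` on a subspace `D` of `H`, as a partially defined operator of `H`. -/
def operatorOn {H : Type u} [NormedAddCommGroup H] [InnerProductSpace ℂ H]
    {D : Submodule ℂ H} (T : Module.End ℂ D) : H →ₗ.[ℂ] H where
  domain := D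
  toFun := D.subtype ∘ₗ T

/-- A quantization of a Poisson subalgebra `𝒞` of `𝒫` on the Hilbert space `H`: a real-linear map
`f ↦ 𝒬(f)` to essentially self-adjoint operators on a common invariant dense domain with
`𝒬({f, g}) = -i [𝒬(f), 𝒬(g)]`, and with `𝒬(1) = I` if `1 ∈ 𝒞`. (If the domain is all of `H`,
these are exactly the bounded self-adjoint operators on `H`.) -/
structure Quantization {s : ℝ} (C : LieSubalgebra ℝ (SpherePoly s)) (H : Type u)
    [NormedAddCommGroup H] [InnerProductSpace ℂ H] [CompleteSpace H] where
  /-- the common invariant domain -/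
  domain : Submodule ℂ H
  dense_domain : Dense (domain : Set H)
  /-- the operators -/
  op : C →ₗ[ℝ] Module.End ℂ domain
  essentially_selfAdjoint : ∀ f : C, IsSelfAdjoint (operatorOn (op f)).closure
  op_bracket : ∀ f g : C, op ⁅f, g⁆ = (-Complex.I) • (op f * op g - op g * op f)
  op_one : ∀ h : (1 : SpherePoly s) ∈ C, op ⟨1, h⟩ = 1

namespace Quantization

variable {s : ℝ} {C C' : LieSubalgebra ℝ (SpherePoly s)} {H : Type u}
  [NormedAddCommGroup H] [InnerProductSpace ℂ H] [CompleteSpace H]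

/-- `𝒬` is irreducible on `ℬ`: the Hilbert space is not zero, and every nonzero subspace of the
domain that is invariant under all `𝒬(f)`, `f ∈ ℬ`, is dense in the Hilbert space. (If the domain
is all of `H`, this says that there is no closed invariant subspace other than `0` and `H`.) -/
def IsIrreducibleOn (Q : Quantization C H) (B : LieSubalgebra ℝ (SpherePoly s)) : Prop :=
  Nontrivial H ∧
    ∀ W : Submodule ℂ H, W ≤ Q.domain →
      (∀ f : C, (f : SpherePoly s) ∈ B → ∀ v : Q.domain, (v : H) ∈ W → (Q.op f v : H) ∈ W) →
      W = ⊥ ∨ Dense (W : Set H)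

/-- `𝒬` is an admissible quantization of the pair `(𝒞, ℬ)`, where `ℬ ⊆ 𝒞`. -/
def IsAdmissible (Q : Quantization C H) (B : LieSubalgebra ℝ (SpherePoly s)) : Prop :=
  B ≤ C ∧ Q.IsIrreducibleOn B

/-- `𝒬` is nontrivial: it does not represent the spin vector by zero. -/
def IsNontrivial (Q : Quantization C H) : Prop :=
  ∃ (i : Fin 3) (h : SpherePoly.spin s i ∈ C), Q.op ⟨SpherePoly.spin s i, h⟩ ≠ 0

/-- `𝒬'` (a quantization of `𝒞'`) extends `𝒬` (a quantization of `𝒞`), where `𝒞 ⊆ 𝒞'`. As the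
algebra grows, the common invariant domain is allowed to shrink. -/
def Extends (Q' : Quantization C' H) (Q : Quantization C H) : Prop :=
  ∃ (hC : C ≤ C') (hD : Q'.domain ≤ Q.domain), ∀ (f : C) (v : Q'.domain),
    (Q'.op ⟨f, hC f.2⟩ v : H) = Q.op f ⟨v, hD v.2⟩

end Quantization

/-- `𝒞` admits a nontrivial quantization (on some Hilbert space) that is admissible, i.e.
irreducible on `𝒫¹`. -/
def AdmitsNontrivialAdmissibleQuantization {s : ℝ} (C : LieSubalgebra ℝ (SpherePoly s)) : Prop :=
  ∃ (H : Type u) (_ : NormedAddCommGroup H) (_ : InnerProductSpace ℂ H) (_ : CompleteSpace H)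
    (Q : Quantization C H), Q.IsAdmissible (SpherePoly.P1 s) ∧ Q.IsNontrivial

/-! Both non-existence statements reduce to one fact, `Quantization.op_spin_eq_zero`: a quantization
of some C strictly larger than P¹ that is irreducible on P¹ kills every spin component. Two
independent ingredients meet there.

Analysis: irreducibility forces the domain to be finite dimensional
(`domain_eq_top_and_finiteDimensional`). The main step is a Schur lemma for the Casimir Ω = S₁² +
S₂² + S₃², available only on the domain and a priori unbounded. Put G = Ω + 1. Then R = G⁻¹ and Bᵢ =
SᵢG⁻¹ extend to bounded operators satisfying the spin relations with R inserted in the commutators.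
A spectral cutoff of R makes the ladder operators nilpotent on a nonzero subspace, which yields a
highest weight vector, and this is an eigenvector of R. By irreducibility Ω is then scalar, so the
Sᵢ are bounded and the usual sl₂ string spans a finite dimensional invariant subspace, which is
closed and dense.

Algebra: write z = S₁ + iS₂. Decomposing an element of C outside P¹ into weights for rotations about
the third axis, and raising a component, gives the real and imaginary parts of some zᵏ with k ≥ 2.
The bracket {zᵏ⁺¹, S₃zᵏ} is a multiple of z²ᵏ⁺¹, so C contains such parts for arbitrarily large k
(`SpherePoly.exists_le_sectorial_mem`).

Together: the quantized zᵏ is an eigenvector, with eigenvalue k, of the commutator with the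
quantized S₃; on a finite dimensional space it vanishes for large k. The kernel of the quantization
is a Lie ideal; it contains {Re zᵏ, Im zᵏ}, a multiple of S₃|z|²ᵏ⁻², and repeated use of the Casimir
on functions brings this down to S₃. Existence on P¹ itself is spin one half. -/

section SpinAlgebra

/-! ### sl₂ relations with an extra operator R in the commutators -/

variable {V : Type*} [AddCommGroup V] [Module ℂ V] {R K E F : Module.End ℂ V}

/-- Each F lowers K by R. The operator R stands for (Ω + 1)⁻¹ in the bounded picture and for 1 in
the original one, so the same algebra serves twice. -/
theorem weight_lowering_pow (hRF : Commute R F) (hKF : K * F = F * K - R * F) (k : ℕ) (v : V) :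
    K ((F ^ k) v) = (F ^ k) (K v) - (k : ℂ) • R ((F ^ k) v) := by
  induction k with
  | zero => simp
  | succ k ih =>
    have h1 : ∀ w, K (F w) = F (K w) - R (F w) := fun w => by
      simpa using congrArg (fun T : Module.End ℂ V => T w) hKF
    have h2 : ∀ w, F (R w) = R (F w) := fun w =>
      (congrArg (fun T : Module.End ℂ V => T w) hRF.eq).symm
    simp only [pow_succ', Module.End.mul_apply, h1, ih, map_sub, map_smul, h2]
    push_cast
    module

/-- Moving E through the k + 1 factors F leaves terms 2RK; the weight shifts 0, R, …, kR add up to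
k(k+1)/2 copies of R. -/
theorem raising_lowering_pow (hRF : Commute R F)
    (hKF : K * F = F * K - R * F) (hEF : E * F = F * E + (2 : ℂ) • (R * K)) (k : ℕ) (v : V) :
    E ((F ^ (k + 1)) v) = (F ^ (k + 1)) (E v) +
      ((k : ℂ) + 1) • R ((F ^ k) ((2 : ℂ) • K v - (k : ℂ) • R v)) := by
  have h1 : ∀ w, E (F w) = F (E w) + (2 : ℂ) • R (K w) := fun w => by
    simpa using congrArg (fun T : Module.End ℂ V => T w) hEF
  have h2 : ∀ w, F (R w) = R (F w) := fun w =>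
    (congrArg (fun T : Module.End ℂ V => T w) hRF.eq).symm
  have h3 : ∀ n w, (F ^ n) (R w) = R ((F ^ n) w) := fun n w =>
    (congrArg (fun T : Module.End ℂ V => T w) (hRF.pow_right n).eq).symm
  induction k with
  | zero => simp [h1]
  | succ k ih =>
    rw [pow_succ', Module.End.mul_apply, h1, ih, weight_lowering_pow hRF hKF]
    simp only [map_add, map_sub, map_smul, h2, h3]
    simp only [pow_succ', Module.End.mul_apply]
    push_cast
    module

/-- Descent on N. If Fᴺ⁺¹w = 0 and Ew = 0, the string formula and injectivity of R give Fᴺ(2Kw −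
NRw) = 0. Either the bracketed vector vanishes and w has highest weight, or it is a new vector
killed by E with a smaller exponent. -/
theorem exists_highest_weight_vector (hRinj : Function.Injective R)
    (hRE : Commute R E) (hRF : Commute R F)
    (hKE : K * E = E * K + R * E) (hKF : K * F = F * K - R * F)
    (hEF : E * F = F * E + (2 : ℂ) • (R * K))
    {w : V} (hw : w ≠ 0) (hEw : E w = 0) {N : ℕ} (hFw : (F ^ N) w = 0) :
    ∃ (k : ℕ) (u : V), u ≠ 0 ∧ E u = 0 ∧ (F ^ (k + 1)) u = 0 ∧ (2 : ℂ) • K u = (k : ℂ) • R u := by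
  induction N generalizing w with
  | zero => exact absurd (by simpa using hFw) hw
  | succ N ih =>
    have h := raising_lowering_pow hRF hKF hEF N w
    rw [hFw, hEw, map_zero, map_zero, zero_add] at h
    have h0 : (F ^ N) ((2 : ℂ) • K w - (N : ℂ) • R w) = 0 := by
      have h1 := (smul_eq_zero.1 h.symm).resolve_left (by exact_mod_cast Nat.succ_ne_zero N)
      exact hRinj (by rw [h1, map_zero])
    by_cases hu : (2 : ℂ) • K w - (N : ℂ) • R w = 0
    · exact ⟨N, w, hw, hEw, hFw, sub_eq_zero.1 hu⟩
    · refine ih hu ?_ h0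
      have h1 : E (K w) = 0 := by
        have := congrArg (fun T : Module.End ℂ V => T w) hKE
        simpa [hEw] using this.symm
      have h2 : E (R w) = 0 := by
        have := congrArg (fun T : Module.End ℂ V => T w) hRE.eq
        simpa [hEw] using this.symm
      simp [h1, h2]

end SpinAlgebra

/-! ### Nilpotency by norm estimates, and an eigenvector of R -/

theorem mul_pow_eq_of_commutator {A : Type*} [Ring A] {R K E : A} (hRE : Commute R E)
    (hKE : K * E = E * K + R * E) (n : ℕ) : K * E ^ n = E ^ n * K + n • (R * E ^ n) := by
  induction n with
  | zero => simp
  | succ n ih =>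
    have h1 : E ^ n * (R * E) = R * E ^ (n + 1) := by
      rw [← mul_assoc, ← (hRE.pow_right n).eq, mul_assoc, pow_succ]
    rw [pow_succ, ← mul_assoc, ih, add_mul, mul_assoc, hKE, mul_add, h1, smul_mul_assoc,
      mul_assoc R, ← pow_succ, succ_nsmul, ← mul_assoc, ← pow_succ]
    abel

/-- The commutator with K has norm at most 2‖K‖, yet it sends X = Eⁿφ to nRX. As h inverts R on the
range of φ, ‖X‖ ≤ ‖h‖‖RX‖; for n > 2‖K‖‖h‖ this forces RX = 0 and hence X = 0. -/
theorem exists_pow_mul_eq_zero {A : Type*} [NormedRing A] [NormedAlgebra ℂ A] {R K E φ h : A}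
    (hRE : Commute R E) (hKE : K * E = E * K + R * E) (hφK : Commute φ K) (hhE : Commute h E)
    (hφ : h * R * φ = φ) : ∃ N : ℕ, ∀ n, N ≤ n → E ^ n * φ = 0 := by
  obtain ⟨N, hN⟩ := exists_nat_gt (2 * ‖K‖ * ‖h‖)
  refine ⟨N, fun n hn => ?_⟩
  set X := E ^ n * φ with hX
  have hXR : h * (R * X) = X := by
    rw [hX, ← mul_assoc R, (hRE.pow_right n).eq, mul_assoc, ← mul_assoc h,
      (hhE.pow_right n).eq, mul_assoc, ← mul_assoc h, hφ]
  have hcomm : (n : ℂ) • (R * X) = K * X - X * K := by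
    rw [hX, mul_assoc (E ^ n), hφK.eq, ← mul_assoc K, mul_pow_eq_of_commutator hRE hKE n, add_mul,
      smul_mul_assoc, Nat.cast_smul_eq_nsmul, mul_assoc R, mul_assoc (E ^ n)]
    abel
  have h1 : (n : ℝ) * ‖R * X‖ ≤ 2 * ‖K‖ * ‖h‖ * ‖R * X‖ := by
    calc (n : ℝ) * ‖R * X‖ = ‖(n : ℂ) • (R * X)‖ := by rw [norm_smul]; simp
      _ ≤ ‖K * X‖ + ‖X * K‖ := by rw [hcomm]; exact norm_sub_le _ _
      _ ≤ ‖K‖ * ‖X‖ + ‖X‖ * ‖K‖ := add_le_add (norm_mul_le _ _) (norm_mul_le _ _)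
      _ = 2 * ‖K‖ * ‖X‖ := by ring
      _ ≤ 2 * ‖K‖ * (‖h‖ * ‖R * X‖) := by
        gcongr
        nth_rewrite 1 [← hXR]
        exact norm_mul_le _ _
      _ = _ := by ring
  have h2 : ‖R * X‖ = 0 := by
    by_contra hne
    have hpos : 0 < ‖R * X‖ := lt_of_le_of_ne (norm_nonneg _) (Ne.symm hne)
    have h3 := le_of_mul_le_mul_right h1 hpos
    have h4 : (N : ℝ) ≤ n := by exact_mod_cast hn
    linarith
  rw [← hXR, norm_eq_zero.1 h2, mul_zero]

theorem exists_pow_mul_eq_zero' {A : Type*} [NormedRing A] [NormedAlgebra ℂ A] {R K F φ h : A}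
    (hRF : Commute R F) (hKF : K * F = F * K - R * F) (hφK : Commute φ K) (hhF : Commute h F)
    (hφ : h * R * φ = φ) : ∃ N : ℕ, ∀ n, N ≤ n → F ^ n * φ = 0 :=
  exists_pow_mul_eq_zero (R := -R) (h := -h) hRF.neg_left (by rw [hKF, neg_mul, sub_eq_add_neg])
    hφK hhF.neg_left (by rw [neg_mul_neg, hφ])

theorem exists_ker_of_pow_eq_zero {V : Type*} [AddCommGroup V] [Module ℂ V] {E : Module.End ℂ V}
    {Y : Submodule ℂ V} (hY : ∀ y ∈ Y, E y ∈ Y) (hne : Y ≠ ⊥) {N : ℕ}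
    (hN : ∀ y ∈ Y, (E ^ N) y = 0) : ∃ w ∈ Y, w ≠ 0 ∧ E w = 0 := by
  obtain ⟨y, hy, hy0⟩ := Y.exists_mem_ne_zero_of_ne_bot hne
  have hyN := hN y hy
  clear hN
  induction N generalizing y with
  | zero => exact absurd (by simpa using hyN) hy0
  | succ N ih =>
    by_cases h : E y = 0
    · exact ⟨y, hy, hy0, h⟩
    · exact ih (E y) (hY y hy) h (by simpa [pow_succ] using hyN)

section Bounded

variable {H : Type*} [NormedAddCommGroup H] [InnerProductSpace ℂ H] [CompleteSpace H]

/-- R need not have a bounded inverse, so it is inverted only on a spectral piece away from 0. -/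
theorem exists_cutoff {R : H →L[ℂ] H} (hR : IsSelfAdjoint R) (hR0 : R ≠ 0) :
    ∃ φ h : H →L[ℂ] H, φ ≠ 0 ∧ h * R * φ = φ ∧
      ∀ T : H →L[ℂ] H, Commute R T → Commute φ T ∧ Commute h T := by
  set ε := ‖R‖ / 2 with hε
  have hε0 : 0 < ε := by have := norm_pos_iff.2 hR0; positivity
  -- f vanishes for |x| ≤ ε, and g(x) = 1/x for |x| ≥ ε, so g(x)·x·f(x) = f(x). If f(R) were 0, the
  -- spectrum would lie in [−ε, ε], contradicting ‖R‖ = 2ε.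
  let f : ℝ → ℝ := fun x => max (|x| - ε) 0
  let g : ℝ → ℝ := fun x => x / max (x ^ 2) (ε ^ 2)
  have hmax : ∀ x : ℝ, max (x ^ 2) (ε ^ 2) ≠ 0 := fun x =>
    (lt_max_of_lt_right (by positivity)).ne'
  have hf : Continuous f := by fun_prop
  have hg : Continuous g := by
    refine Continuous.div continuous_id (by fun_prop) hmax
  refine ⟨cfc f R, cfc g R, ?_, ?_, fun T hT =>
    ⟨hT.cfc_real f, hT.cfc_real g⟩⟩
  · intro h0
    have h1 : ∀ x ∈ spectrum ℝ R, |x| ≤ ε := by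
      intro x hx
      have h2 := norm_apply_le_norm_cfc f R hx hf.continuousOn hR
      rw [h0, norm_zero, Real.norm_eq_abs] at h2
      have h3 : f x = 0 := abs_eq_zero.1 (le_antisymm h2 (abs_nonneg _))
      have h4 : |x| - ε ≤ f x := le_max_left _ _
      linarith
    have h2 : ‖cfc (fun x : ℝ => x) R‖ ≤ ε := norm_cfc_le hε0.le h1
    rw [cfc_id' ℝ R] at h2
    have := norm_pos_iff.2 hR0
    linarith
  · have hid : R = cfc (fun x : ℝ => x) R := (cfc_id' ℝ R).symm
    have h1 : cfc g R * R = cfc (fun x => g x * x) R := by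
      nth_rewrite 2 [hid]
      rw [← cfc_mul g (fun x => x) R hg.continuousOn continuousOn_id]
    rw [h1, ← cfc_mul (fun x => g x * x) f R (hg.mul continuous_id).continuousOn hf.continuousOn]
    congr 1
    funext x
    rcases le_total (|x|) ε with hx | hx
    · simp [f, hx]
    · have : ε ^ 2 ≤ x ^ 2 := by rw [← sq_abs x]; gcongr
      have hx2 : x ^ 2 ≠ 0 := by rw [← max_eq_left this]; exact hmax x
      have hx0 : x ≠ 0 := by rintro rfl; simp at hx2
      simp only [g, max_eq_left this]
      field_simp

/-- On the range of the cutoff, E and F are nilpotent, so a highest weight vector u exists. The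
formula for FE then turns Eu = 0 and 2Ku = kRu into a quadratic relation in R alone, and injectivity
of R makes it linear. -/
theorem exists_eigenvector_of_bounded_spin {R K E F : H →L[ℂ] H} (hR : IsSelfAdjoint R)
    (hR0 : R ≠ 0) (hRinj : Function.Injective R)
    (hRK : Commute R K) (hRE : Commute R E) (hRF : Commute R F)
    (hKE : K * E = E * K + R * E) (hKF : K * F = F * K - R * F)
    (hEF : E * F = F * E + (2 : ℂ) • (R * K)) (hFE : F * E = R - R * R - K * K - R * K) :
    ∃ (ρ : ℂ) (u : H), u ≠ 0 ∧ R u = ρ • u := by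
  obtain ⟨φ, h, hφ0, hφ, hcomm⟩ := exists_cutoff hR hR0
  obtain ⟨N, hN⟩ := exists_pow_mul_eq_zero hRE hKE (hcomm K hRK).1 (hcomm E hRE).2 hφ
  obtain ⟨M, hM⟩ := exists_pow_mul_eq_zero' hRF hKF (hcomm K hRK).1 (hcomm F hRF).2 hφ
  have hpow : ∀ (T : H →L[ℂ] H) (n : ℕ) (v : H),
      ((T : Module.End ℂ H) ^ n) v = (T ^ n) v := fun T n v => by
    induction n generalizing v with
    | zero => rfl
    | succ n ih => rw [pow_succ, pow_succ, Module.End.mul_apply, ih]; rfl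
  obtain ⟨w, ⟨x, rfl⟩, hw0, hEw⟩ := exists_ker_of_pow_eq_zero (E := (E : Module.End ℂ H))
    (Y := LinearMap.range (φ : H →ₗ[ℂ] H)) (N := N)
    (by
      rintro _ ⟨x, rfl⟩
      exact ⟨E x, congrArg (fun T : H →L[ℂ] H => T x) (hcomm E hRE).1.eq⟩)
    (by
      intro h0
      refine hφ0 (ContinuousLinearMap.ext fun x => ?_)
      have : φ x ∈ LinearMap.range (φ : H →ₗ[ℂ] H) := ⟨x, rfl⟩
      rw [h0] at this
      simpa using this)
    (by
      rintro _ ⟨x, rfl⟩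
      rw [hpow]
      exact congrArg (fun T : H →L[ℂ] H => T x) (hN N le_rfl))
  have lift : ∀ {S T : H →L[ℂ] H}, S = T → (S : Module.End ℂ H) = T := fun h => by rw [h]
  obtain ⟨k, u, hu0, hEu, -, hKu⟩ := exists_highest_weight_vector (R := (R : Module.End ℂ H))
    (K := K) (E := E) (F := F) (N := M) hRinj (lift hRE.eq) (lift hRF.eq)
    (lift hKE) (lift hKF) (lift hEF) hw0 hEw (by
      rw [hpow]
      exact congrArg (fun T : H →L[ℂ] H => T x) (hM M le_rfl))
  have hKu' : K u = ((k : ℂ) / 2) • R u := by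
    have : (2 : ℂ) • K u = (k : ℂ) • R u := hKu
    rw [div_eq_inv_mul, mul_smul, ← this, smul_smul]
    norm_num
  have hEu' : E u = 0 := hEu
  have h1 : R u - R (R u) - K (K u) - R (K u) = 0 := by
    have := congrArg (fun T : H →L[ℂ] H => T u) hFE
    simpa [hEu'] using this.symm
  have hKR : K (R u) = R (K u) := (congrArg (fun T : H →L[ℂ] H => T u) hRK.eq).symm
  rw [hKu', map_smul, hKR, hKu', map_smul, smul_smul] at h1
  -- With j = k/2 this is 1 + j(j+1), the value of Ω + 1 on spin j.
  set c : ℂ := 1 + (k : ℂ) / 2 * (k / 2) + k / 2 with hc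
  have h2 : R (u - c • R u) = 0 := by
    rw [← h1, hc, map_sub, map_smul]
    module
  have h3 : u = c • R u := sub_eq_zero.1 (hRinj (by rw [h2, map_zero]))
  have hc0 : c ≠ 0 := by
    rintro h0
    rw [h0, zero_smul] at h3
    exact hu0 h3
  refine ⟨c⁻¹, u, hu0, ?_⟩
  nth_rewrite 2 [h3]
  rw [smul_smul, inv_mul_cancel₀ hc0, one_smul]

end Bounded

/-! ### Ladder operators and Casimir estimates for spin triples -/

theorem ladder_relations {A : Type*} [Ring A] [Algebra ℂ A] {R B₁ B₂ B₃ : A}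
    (h₁₂ : B₁ * B₂ = B₂ * B₁ + Complex.I • (R * B₃))
    (h₂₃ : B₂ * B₃ = B₃ * B₂ + Complex.I • (R * B₁))
    (h₃₁ : B₃ * B₁ = B₁ * B₃ + Complex.I • (R * B₂)) :
    B₃ * (B₁ + Complex.I • B₂) = (B₁ + Complex.I • B₂) * B₃ + R * (B₁ + Complex.I • B₂) ∧
    B₃ * (B₁ - Complex.I • B₂) = (B₁ - Complex.I • B₂) * B₃ - R * (B₁ - Complex.I • B₂) ∧
    (B₁ + Complex.I • B₂) * (B₁ - Complex.I • B₂) =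
      (B₁ - Complex.I • B₂) * (B₁ + Complex.I • B₂) + (2 : ℂ) • (R * B₃) ∧
    (B₁ - Complex.I • B₂) * (B₁ + Complex.I • B₂) = B₁ * B₁ + B₂ * B₂ - R * B₃ := by
  have i₁₂ : Complex.I • (B₁ * B₂) = Complex.I • (B₂ * B₁) - R * B₃ := by
    rw [h₁₂, smul_add, smul_smul, Complex.I_mul_I]; module
  have i₂₃ : Complex.I • (B₂ * B₃) = Complex.I • (B₃ * B₂) - R * B₁ := by
    rw [h₂₃, smul_add, smul_smul, Complex.I_mul_I]; module
  simp only [mul_add, add_mul, mul_sub, sub_mul, smul_mul_assoc, mul_smul_comm, smul_smul,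
    Complex.I_mul_I, smul_add, smul_sub]
  refine ⟨?_, ?_, ?_, ?_⟩
  · rw [h₃₁, i₂₃]; module
  · rw [h₃₁, i₂₃]; module
  · rw [i₁₂]; module
  · rw [i₁₂]; module

/-- Symmetric operators satisfying the commutation relations `[S₁, S₂] = i S₃` (cyclically). -/
structure IsSpinTriple {V : Type*} [NormedAddCommGroup V] [InnerProductSpace ℂ V]
    (S₁ S₂ S₃ : Module.End ℂ V) : Prop where
  symm₁ : S₁.IsSymmetric
  symm₂ : S₂.IsSymmetric
  symm₃ : S₃.IsSymmetric
  comm₁₂ : S₁ * S₂ = S₂ * S₁ + Complex.I • S₃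
  comm₂₃ : S₂ * S₃ = S₃ * S₂ + Complex.I • S₁
  comm₃₁ : S₃ * S₁ = S₁ * S₃ + Complex.I • S₂

namespace IsSpinTriple

variable {V : Type*} [NormedAddCommGroup V] [InnerProductSpace ℂ V] {S₁ S₂ S₃ : Module.End ℂ V}

/-- Cyclic symmetry: what is proved for S₁ alone transfers to S₂ and S₃. -/
theorem rotate (h : IsSpinTriple S₁ S₂ S₃) : IsSpinTriple S₂ S₃ S₁ :=
  ⟨h.symm₂, h.symm₃, h.symm₁, h.comm₂₃, h.comm₃₁, h.comm₁₂⟩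

theorem commute_casimir (h : IsSpinTriple S₁ S₂ S₃) :
    Commute (S₁ * S₁ + S₂ * S₂ + S₃ * S₃) S₁ := by
  have h1 : S₂ * S₂ * S₁ = S₁ * (S₂ * S₂) - Complex.I • (S₃ * S₂ + S₂ * S₃) := by
    have : S₂ * S₁ = S₁ * S₂ - Complex.I • S₃ := by rw [h.comm₁₂]; abel
    rw [mul_assoc, this, mul_sub, ← mul_assoc, this, sub_mul]
    simp only [mul_smul_comm, smul_mul_assoc, mul_assoc]
    module
  have h2 : S₃ * S₃ * S₁ = S₁ * (S₃ * S₃) + Complex.I • (S₃ * S₂ + S₂ * S₃) := by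
    rw [mul_assoc, h.comm₃₁, mul_add, ← mul_assoc, h.comm₃₁, add_mul]
    simp only [mul_smul_comm, smul_mul_assoc, mul_assoc]
    module
  rw [commute_iff_eq, add_mul, add_mul, h1, h2, mul_add, mul_add, mul_assoc]
  abel

theorem inner_casimir (h : IsSpinTriple S₁ S₂ S₃) (v w : V) :
    inner ℂ ((S₁ * S₁ + S₂ * S₂ + S₃ * S₃) v) w =
      inner ℂ (S₁ v) (S₁ w) + inner ℂ (S₂ v) (S₂ w) + inner ℂ (S₃ v) (S₃ w) := by
  simp only [LinearMap.add_apply, Module.End.mul_apply, inner_add_left, h.symm₁ (S₁ v) w,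
    h.symm₂ (S₂ v) w, h.symm₃ (S₃ v) w]

theorem re_inner_casimir_add_one (h : IsSpinTriple S₁ S₂ S₃) (v : V) :
    RCLike.re (inner ℂ ((S₁ * S₁ + S₂ * S₂ + S₃ * S₃ + 1) v) v) =
      ‖S₁ v‖ ^ 2 + ‖S₂ v‖ ^ 2 + ‖S₃ v‖ ^ 2 + ‖v‖ ^ 2 := by
  rw [LinearMap.add_apply, inner_add_left, h.inner_casimir]
  simp only [map_add, Module.End.one_apply, inner_self_eq_norm_sq]

theorem symm_casimir_add_one (h : IsSpinTriple S₁ S₂ S₃) :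
    (S₁ * S₁ + S₂ * S₂ + S₃ * S₃ + 1).IsSymmetric := by
  intro v w
  simp only [LinearMap.add_apply, Module.End.mul_apply, inner_add_left, inner_add_right,
    Module.End.one_apply, h.symm₁ (S₁ v) w, h.symm₂ (S₂ v) w, h.symm₃ (S₃ v) w,
    h.symm₁ v (S₁ w), h.symm₂ v (S₂ w), h.symm₃ v (S₃ w)]

theorem norm_le_casimir_add_one (h : IsSpinTriple S₁ S₂ S₃) (v : V) :
    ‖v‖ ≤ ‖(S₁ * S₁ + S₂ * S₂ + S₃ * S₃ + 1) v‖ := by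
  have h1 := h.re_inner_casimir_add_one v
  have h2 := re_inner_le_norm (𝕜 := ℂ) ((S₁ * S₁ + S₂ * S₂ + S₃ * S₃ + 1) v) v
  by_cases h0 : ‖v‖ = 0
  · rw [h0]; positivity
  have h3 : 0 < ‖v‖ := lt_of_le_of_ne (norm_nonneg _) (Ne.symm h0)
  refine le_of_mul_le_mul_right ?_ h3
  nlinarith [sq_nonneg ‖S₁ v‖, sq_nonneg ‖S₂ v‖, sq_nonneg ‖S₃ v‖]

/-- ‖S₁v‖² ≤ Re⟨Gv, v⟩ ≤ ‖Gv‖‖v‖ ≤ ‖Gv‖², where G = Ω + 1. This is what makes S₁G⁻¹ a contraction.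
-/
theorem norm_apply_le_casimir_add_one (h : IsSpinTriple S₁ S₂ S₃) (v : V) :
    ‖S₁ v‖ ≤ ‖(S₁ * S₁ + S₂ * S₂ + S₃ * S₃ + 1) v‖ := by
  have h1 := h.re_inner_casimir_add_one v
  have h2 := re_inner_le_norm (𝕜 := ℂ) ((S₁ * S₁ + S₂ * S₂ + S₃ * S₃ + 1) v) v
  have h3 := h.norm_le_casimir_add_one v
  refine le_of_sq_le_sq ?_ (norm_nonneg _)
  nlinarith [sq_nonneg ‖S₂ v‖, sq_nonneg ‖S₃ v‖, sq_nonneg ‖v‖, norm_nonneg v,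
    norm_nonneg ((S₁ * S₁ + S₂ * S₂ + S₃ * S₃ + 1) v)]

theorem norm_apply_le_of_casimir_eq (h : IsSpinTriple S₁ S₂ S₃) {c : ℂ}
    (hc : ∀ v, (S₁ * S₁ + S₂ * S₂ + S₃ * S₃) v = c • v) (v : V) :
    ‖S₁ v‖ ≤ Real.sqrt ‖c‖ * ‖v‖ := by
  have h1 := congrArg RCLike.re (h.inner_casimir v v)
  rw [hc v] at h1
  simp only [map_add, inner_self_eq_norm_sq] at h1
  have h2 := re_inner_le_norm (𝕜 := ℂ) (c • v) v
  rw [norm_smul] at h2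
  refine le_of_sq_le_sq ?_ (by positivity)
  rw [mul_pow, Real.sq_sqrt (norm_nonneg _)]
  nlinarith [sq_nonneg ‖S₂ v‖, sq_nonneg ‖S₃ v‖]

end IsSpinTriple

/-! ### Irreducible spin triples are finite dimensional -/

section Irreducible

variable {H : Type*} [NormedAddCommGroup H] [InnerProductSpace ℂ H] [CompleteSpace H]
  {D : Submodule ℂ H} {S₁ S₂ S₃ : Module.End ℂ D}

/-- An eigenvector u of the bounded operator G⁻¹ is orthogonal to the range of G − ρ⁻¹. That range
is an invariant subspace, so irreducibility makes it zero. The vector u itself need not lie in the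
domain. -/
theorem casimir_eq_smul_of_irreducible (h : IsSpinTriple S₁ S₂ S₃) (hD : D ≠ ⊥)
    (hirr : ∀ W : Submodule ℂ D, (∀ v ∈ W, S₁ v ∈ W ∧ S₂ v ∈ W ∧ S₃ v ∈ W) →
      W = ⊥ ∨ Dense (W.map D.subtype : Set H)) :
    ∃ c : ℂ, ∀ v, (S₁ * S₁ + S₂ * S₂ + S₃ * S₃) v = c • v := by
  set Ω := S₁ * S₁ + S₂ * S₂ + S₃ * S₃ with hΩ
  have hΩ₂ : S₂ * S₂ + S₃ * S₃ + S₁ * S₁ = Ω := by rw [hΩ]; abel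
  have hΩ₃ : S₃ * S₃ + S₁ * S₁ + S₂ * S₂ = Ω := by rw [hΩ]; abel
  have hc₁ : Commute Ω S₁ := h.commute_casimir
  have hc₂ : Commute Ω S₂ := hΩ₂ ▸ h.rotate.commute_casimir
  have hc₃ : Commute Ω S₃ := hΩ₃ ▸ h.rotate.rotate.commute_casimir
  have hrange : ∀ T : Module.End ℂ D, Commute T S₁ → Commute T S₂ → Commute T S₃ →
      LinearMap.range T = ⊥ ∨ Dense ((LinearMap.range T).map D.subtype : Set H) := by
    intro T h1 h2 h3
    refine hirr _ ?_
    rintro _ ⟨v, rfl⟩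
    exact ⟨⟨S₁ v, congrArg (fun X : Module.End ℂ D => X v) h1.eq⟩,
      ⟨S₂ v, congrArg (fun X : Module.End ℂ D => X v) h2.eq⟩,
      ⟨S₃ v, congrArg (fun X : Module.End ℂ D => X v) h3.eq⟩⟩
  set G := Ω + 1 with hG
  have hGc : ∀ {T}, Commute Ω T → Commute G T := fun hT => hT.add_left (Commute.one_left _)
  have hGn : ∀ v, ‖v‖ ≤ ‖G v‖ := h.norm_le_casimir_add_one
  have hGs : G.IsSymmetric := h.symm_casimir_add_one
  let e : D →ₗ[ℂ] H := D.subtype ∘ₗ G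
  -- Irreducibility supplies the density of the range of G; no essential self-adjointness of Ω is
  -- needed.
  have hdense : DenseRange e := by
    have hne : LinearMap.range G ≠ ⊥ := by
      intro h0
      refine hD ((Submodule.eq_bot_iff _).2 fun v hv => ?_)
      have h1 : G ⟨v, hv⟩ = 0 := LinearMap.congr_fun (LinearMap.range_eq_bot.1 h0) _
      have h2 := hGn ⟨v, hv⟩
      rw [h1, norm_zero] at h2
      simpa using norm_le_zero_iff.1 h2
    have := (hrange G (hGc hc₁) (hGc hc₂) (hGc hc₃)).resolve_left hne
    rw [← LinearMap.range_comp] at this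
    exact this
  -- The bounded extension of TG⁻¹ from the range of G to H.
  let ext : Module.End ℂ D → (H →L[ℂ] H) := fun T => (D.subtype ∘ₗ T).extendOfNorm e
  have hext : ∀ T : Module.End ℂ D, (∀ v, ‖T v‖ ≤ ‖G v‖) → ∀ v, ext T (e v) = T v :=
    fun T hT v => LinearMap.extendOfNorm_eq hdense ⟨1, fun x => by
      rw [one_mul]; exact hT x⟩ v
  have hR := hext 1 hGn
  have h₁ := hext S₁ h.norm_apply_le_casimir_add_one
  have h₂ := hext S₂ (by rw [hG, ← hΩ₂]; exact h.rotate.norm_apply_le_casimir_add_one)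
  have h₃ := hext S₃ (by rw [hG, ← hΩ₃]; exact h.rotate.rotate.norm_apply_le_casimir_add_one)
  set R := ext 1
  set B₁ := ext S₁
  set B₂ := ext S₂
  set B₃ := ext S₃
  have hRe : ∀ v, R (e v) = v := hR
  -- The extensions have a known value only on the range of G, so products cannot be computed
  -- directly. Identities are tested on matrix coefficients, where symmetry moves one factor to the
  -- other side.
  have hinner : ∀ A A' : H →L[ℂ] H,
      (∀ v w : D, inner ℂ (A (e v)) (e w) = inner ℂ (A' (e v)) (e w)) → A = A' := by
    intro A A' hA
    refine ContinuousLinearMap.ext fun x => ?_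
    refine hdense.induction_on (p := fun x => A x = A' x) x
      (isClosed_eq A.continuous A'.continuous) fun v => ?_
    exact hdense.eq_of_inner_left ℂ fun w => hA v w
  have hsymm : ∀ (T : Module.End ℂ D) (B : H →L[ℂ] H), T.IsSymmetric → Commute G T →
      (∀ v, B (e v) = T v) → ∀ x y, inner ℂ (B x) y = inner ℂ x (B y) := by
    intro T B hT hGT hB
    have key : ∀ v w, inner ℂ (B (e v)) (e w) = inner ℂ (e v) (B (e w)) := by
      intro v w
      rw [hB, hB]
      change inner ℂ (T v) (G w) = inner ℂ (G v) (T w)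
      rw [← hGs (T v) w, ← hT (G v) w]
      exact congrArg (fun z => inner ℂ z w) (congrArg (fun X : Module.End ℂ D => X v) hGT.eq)
    intro x y
    refine hdense.induction_on (p := fun x => inner ℂ (B x) y = inner ℂ x (B y)) x
      (isClosed_eq (by fun_prop) (by fun_prop)) fun v => ?_
    exact hdense.induction_on (p := fun y => inner ℂ (B (e v)) y = inner ℂ (e v) (B y)) y
      (isClosed_eq (by fun_prop) (by fun_prop)) fun w => key v w
  have sR := hsymm 1 R (fun _ _ => rfl) (Commute.one_right _) hR
  have s₁ := hsymm S₁ B₁ h.symm₁ (hGc hc₁) h₁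
  have s₂ := hsymm S₂ B₂ h.symm₂ (hGc hc₂) h₂
  have s₃ := hsymm S₃ B₃ h.symm₃ (hGc hc₃) h₃
  have hcoe : ∀ a b : D, inner ℂ (a : H) (b : H) = inner ℂ a b := fun _ _ => rfl
  have hcommR : ∀ (T : Module.End ℂ D) (B : H →L[ℂ] H), T.IsSymmetric →
      (∀ v, B (e v) = T v) → (∀ x y, inner ℂ (B x) y = inner ℂ x (B y)) → Commute R B := by
    intro T B hT hB hBs
    refine hinner _ _ fun v w => ?_
    rw [mul_apply_eq_comp, mul_apply_eq_comp, sR, hRe w, hB v, hRe v, hBs, hB w]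
    exact hT v w
  have hcomm : ∀ (S T U : Module.End ℂ D) (B B' B'' : H →L[ℂ] H), S.IsSymmetric →
      T.IsSymmetric → (∀ v, B (e v) = S v) → (∀ v, B' (e v) = T v) → (∀ v, B'' (e v) = U v) →
      (∀ x y, inner ℂ (B x) y = inner ℂ x (B y)) → (∀ x y, inner ℂ (B' x) y = inner ℂ x (B' y)) →
      S * T = T * S + Complex.I • U → B * B' = B' * B + Complex.I • (R * B'') := by
    intro S T U B B' B'' hS hT hB hB' hB'' hBs hBs' hST
    refine hinner _ _ fun v w => ?_
    simp only [add_apply, smul_apply, inner_add_left,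
      inner_smul_left, mul_apply_eq_comp]
    rw [hBs (B' (e v)), hBs' (B (e v)), sR]
    simp only [hB, hB', hB'', hRe, hcoe]
    rw [← hS, ← hT]
    have := congrArg (fun X : Module.End ℂ D => inner ℂ (X v) w) hST
    simpa [inner_add_left, inner_smul_left, mul_comm] using this
  have hcas : B₁ * B₁ + B₂ * B₂ + B₃ * B₃ = R - R * R := by
    refine hinner _ _ fun v w => ?_
    simp only [add_apply, sub_apply, inner_add_left,
      inner_sub_left, mul_apply_eq_comp]
    rw [s₁, s₂, s₃, sR (R (e v)), h₁, h₁, h₂, h₂, h₃, h₃, hRe, hRe]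
    simp only [hcoe]
    change _ = inner ℂ v (G w) - inner ℂ v w
    have hGv : G v = Ω v + v := rfl
    rw [← hGs, hGv, inner_add_left, add_sub_cancel_right]
    exact (h.inner_casimir v w).symm
  have hRsa : IsSelfAdjoint R := by
    rw [ContinuousLinearMap.isSelfAdjoint_iff_isSymmetric]
    exact sR
  have hRinj : Function.Injective R := by
    rw [injective_iff_map_eq_zero]
    intro x hx
    refine hdense.eq_of_inner_left ℂ fun v => ?_
    have h1 : e v = R (e (G v)) := (hRe (G v)).symm
    rw [h1, ← sR, hx, inner_zero_left, inner_zero_left]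
  have hR0 : R ≠ 0 := by
    intro h0
    refine hD ((Submodule.eq_bot_iff _).2 fun v hv => ?_)
    have := hRe ⟨v, hv⟩
    rw [h0] at this
    exact this.symm
  have cR₁ := hcommR S₁ B₁ h.symm₁ h₁ s₁
  have cR₂ := hcommR S₂ B₂ h.symm₂ h₂ s₂
  have cR₃ := hcommR S₃ B₃ h.symm₃ h₃ s₃
  obtain ⟨r₁, r₂, r₃, r₄⟩ := ladder_relations
    (hcomm S₁ S₂ S₃ B₁ B₂ B₃ h.symm₁ h.symm₂ h₁ h₂ h₃ s₁ s₂ h.comm₁₂)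
    (hcomm S₂ S₃ S₁ B₂ B₃ B₁ h.symm₂ h.symm₃ h₂ h₃ h₁ s₂ s₃ h.comm₂₃)
    (hcomm S₃ S₁ S₂ B₃ B₁ B₂ h.symm₃ h.symm₁ h₃ h₁ h₂ s₃ s₁ h.comm₃₁)
  obtain ⟨ρ, u, hu0, hu⟩ := exists_eigenvector_of_bounded_spin hRsa hR0 hRinj cR₃
    (cR₁.add_right (cR₂.smul_right _)) (cR₁.sub_right (cR₂.smul_right _)) r₁ r₂ r₃ (by
      rw [r₄, ← hcas]; abel)
  have hρ : ρ ≠ 0 := by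
    rintro rfl
    exact hu0 (hRinj (by rw [hu, zero_smul, map_zero]))
  have hρr : (starRingEnd ℂ) ρ = ρ := by
    have h1 := sR u u
    rw [hu, inner_smul_left, inner_smul_right] at h1
    exact mul_right_cancel₀ (inner_self_ne_zero.2 hu0) h1
  refine ⟨ρ⁻¹ - 1, ?_⟩
  have hT := hrange (G - algebraMap ℂ (Module.End ℂ D) ρ⁻¹)
    ((hGc hc₁).sub_left (Algebra.commutes _ _)) ((hGc hc₂).sub_left (Algebra.commutes _ _))
    ((hGc hc₃).sub_left (Algebra.commutes _ _))
  rcases hT with hT | hT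
  · intro v
    have h1 := LinearMap.congr_fun (LinearMap.range_eq_bot.1 hT) v
    simp only [LinearMap.sub_apply, hG, LinearMap.add_apply, Module.End.one_apply,
      Module.algebraMap_end_apply, LinearMap.zero_apply] at h1
    rw [sub_smul, one_smul, ← sub_eq_zero, ← h1]
    abel
  · exfalso
    refine hu0 (hT.eq_zero_of_inner_left ℂ ?_)
    rintro _ ⟨_, ⟨v, rfl⟩, rfl⟩
    have h1 : inner ℂ u (v : H) = ρ * inner ℂ u (e v) := by
      rw [← hRe v, ← sR, hu, inner_smul_left, hρr]
    simp only [Submodule.subtype_apply, LinearMap.sub_apply, Module.algebraMap_end_apply,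
      Submodule.coe_sub, Submodule.coe_smul, inner_sub_right, inner_smul_right]
    rw [h1, ← mul_assoc, inv_mul_cancel₀ hρ, one_mul]
    exact sub_self _

theorem domain_eq_top_and_finiteDimensional (h : IsSpinTriple S₁ S₂ S₃) (hD : D ≠ ⊥)
    (hirr : ∀ W : Submodule ℂ D, (∀ v ∈ W, S₁ v ∈ W ∧ S₂ v ∈ W ∧ S₃ v ∈ W) →
      W = ⊥ ∨ Dense (W.map D.subtype : Set H)) :
    D = ⊤ ∧ FiniteDimensional ℂ D := by
  obtain ⟨c, hc⟩ := casimir_eq_smul_of_irreducible h hD hirr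
  obtain ⟨hKE, hKF, hEF, -⟩ := ladder_relations (R := 1) (B₁ := S₁) (B₂ := S₂) (B₃ := S₃)
    (by rw [one_mul, h.comm₁₂]) (by rw [one_mul, h.comm₂₃]) (by rw [one_mul, h.comm₃₁])
  have hc₂ : ∀ v, (S₂ * S₂ + S₃ * S₃ + S₁ * S₁) v = c • v := fun v => by
    rw [← hc v]; simp only [LinearMap.add_apply]; abel
  have hc₃ : ∀ v, (S₃ * S₃ + S₁ * S₁ + S₂ * S₂) v = c • v := fun v => by
    rw [← hc v]; simp only [LinearMap.add_apply]; abel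
  let B₁ : D →L[ℂ] D := S₁.mkContinuous _ (h.norm_apply_le_of_casimir_eq hc)
  let B₂ : D →L[ℂ] D := S₂.mkContinuous _ (h.rotate.norm_apply_le_of_casimir_eq hc₂)
  let B₃ : D →L[ℂ] D := S₃.mkContinuous _ (h.rotate.rotate.norm_apply_le_of_casimir_eq hc₃)
  have hpow : ∀ (T : D →L[ℂ] D) (n : ℕ) (v : D),
      ((T : Module.End ℂ D) ^ n) v = (T ^ n) v := fun T n v => by
    induction n generalizing v with
    | zero => rfl
    | succ n ih => rw [pow_succ, pow_succ, Module.End.mul_apply, ih]; rfl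
  -- Now that the Sᵢ are bounded, the norm estimate applies without a cutoff: R, φ and h are all 1.
  obtain ⟨N, hN⟩ := exists_pow_mul_eq_zero (R := 1) (K := B₃) (E := B₁ + Complex.I • B₂) (φ := 1)
    (h := 1) (Commute.one_left _)
    (ContinuousLinearMap.ext fun v => congrArg (fun X : Module.End ℂ D => X v) hKE)
    (Commute.one_left _) (Commute.one_left _) (by simp)
  obtain ⟨M, hM⟩ := exists_pow_mul_eq_zero' (R := 1) (K := B₃) (F := B₁ - Complex.I • B₂) (φ := 1)
    (h := 1) (Commute.one_left _)
    (ContinuousLinearMap.ext fun v => congrArg (fun X : Module.End ℂ D => X v) hKF)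
    (Commute.one_left _) (Commute.one_left _) (by simp)
  set E := S₁ + Complex.I • S₂ with hE
  set F := S₁ - Complex.I • S₂ with hF
  have hEN : ∀ v, (E ^ N) v = 0 := fun v => by
    refine (hpow (B₁ + Complex.I • B₂) N v).trans ?_
    simpa using congrArg (fun T : D →L[ℂ] D => T v) (hN N le_rfl)
  have hFM : ∀ v, (F ^ M) v = 0 := fun v => by
    refine (hpow (B₁ - Complex.I • B₂) M v).trans ?_
    simpa using congrArg (fun T : D →L[ℂ] D => T v) (hM M le_rfl)
  have hDtop : (⊤ : Submodule ℂ D) ≠ ⊥ := by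
    intro h0
    refine hD ((Submodule.eq_bot_iff _).2 fun v hv => ?_)
    have : (⟨v, hv⟩ : D) ∈ (⊥ : Submodule ℂ D) := h0 ▸ Submodule.mem_top
    simpa using this
  obtain ⟨w, -, hw0, hEw⟩ := exists_ker_of_pow_eq_zero (E := E) (Y := ⊤)
    (fun _ _ => Submodule.mem_top) hDtop (fun y _ => hEN y)
  obtain ⟨k, u, hu0, hEu, hFu, hKu⟩ := exists_highest_weight_vector (R := 1)
    Function.injective_id (Commute.one_left _) (Commute.one_left _) hKE hKF hEF hw0 hEw (hFM w)
  rw [Module.End.one_apply] at hKu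
  let W := Submodule.span ℂ (Set.range fun j : Fin (k + 1) => (F ^ (j : ℕ)) u)
  have hmem : ∀ j : ℕ, (F ^ j) u ∈ W := by
    intro j
    rcases lt_or_ge j (k + 1) with hj | hj
    · exact Submodule.subset_span ⟨⟨j, hj⟩, rfl⟩
    · obtain ⟨i, rfl⟩ := Nat.exists_eq_add_of_le' hj
      rw [pow_add, Module.End.mul_apply, hFu, map_zero]
      exact W.zero_mem
  have hstep : ∀ T : Module.End ℂ D, (∀ j : ℕ, T ((F ^ j) u) ∈ W) → ∀ v ∈ W, T v ∈ W := by
    intro T hT v hv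
    have : W ≤ W.comap T := Submodule.span_le.2 (by rintro _ ⟨j, rfl⟩; exact hT j)
    exact this hv
  have hKu' : S₃ u = ((k : ℂ) / 2) • u := by
    rw [div_eq_inv_mul, mul_smul, ← hKu, smul_smul]
    norm_num
  have hFW := hstep F fun j => by
    rw [← Module.End.mul_apply, ← pow_succ']
    exact hmem _
  have hKW := hstep S₃ fun j => by
    rw [weight_lowering_pow (Commute.one_left _) hKF, hKu', map_smul]
    exact W.sub_mem (W.smul_mem _ (hmem j)) (W.smul_mem _ (hmem j))
  have hEW := hstep E fun j => by
    rcases j with - | j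
    · rw [pow_zero, Module.End.one_apply, hEu]
      exact W.zero_mem
    · rw [raising_lowering_pow (Commute.one_left _) hKF hEF, hEu, map_zero, zero_add, hKu,
        Module.End.one_apply, Module.End.one_apply, ← sub_smul, map_smul]
      exact W.smul_mem _ (W.smul_mem _ (hmem j))
  have hW := hirr W fun v hv => by
    have h1 := hEW v hv
    have h2 := hFW v hv
    refine ⟨?_, ?_, hKW v hv⟩
    · have : S₁ v = (2⁻¹ : ℂ) • (E v + F v) := by
        simp only [hE, hF, LinearMap.add_apply, LinearMap.sub_apply, LinearMap.smul_apply]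
        module
      rw [this]
      exact W.smul_mem _ (W.add_mem h1 h2)
    · have : S₂ v = (-Complex.I * 2⁻¹) • (E v - F v) := by
        have h3 : E v - F v = (2 * Complex.I) • S₂ v := by
          simp only [hE, hF, LinearMap.add_apply, LinearMap.sub_apply, LinearMap.smul_apply]
          module
        rw [h3, smul_smul, show -Complex.I * 2⁻¹ * (2 * Complex.I) = -(Complex.I * Complex.I) by
          ring, Complex.I_mul_I, neg_neg, one_smul]
      rw [this]
      exact W.smul_mem _ (W.sub_mem h1 h2)
  have hWfin : FiniteDimensional ℂ W := FiniteDimensional.span_of_finite ℂ (Set.finite_range _)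
  have hWne : W ≠ ⊥ := fun h0 => hu0 (by
    have := hmem 0
    rw [h0] at this
    simpa using this)
  have hWd := hW.resolve_left hWne
  have hWtop : W.map D.subtype = ⊤ := by
    -- Finite dimension makes W closed; being dense it is all of H, and it lies inside D.
    have hcl : IsClosed (W.map D.subtype : Set H) := Submodule.closed_of_finiteDimensional _
    exact SetLike.coe_injective (hcl.closure_eq.symm.trans hWd.closure_eq)
  have hDT : D = ⊤ := top_le_iff.1 (hWtop ▸ Submodule.map_subtype_le D W)
  refine ⟨hDT, ?_⟩
  have hWtop' : W = ⊤ := by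
    refine Submodule.map_injective_of_injective D.injective_subtype ?_
    rw [hWtop, Submodule.map_top, Submodule.range_subtype, hDT]
  rw [hWtop'] at hWfin
  exact Module.finite_def.2 (Submodule.fg_top _ |>.1 (Module.finite_def.1 hWfin))

end Irreducible

/-! ### Polynomial identities for powers of z = S₁ + iS₂ -/

open MvPolynomial in
theorem spinBracket_X_zero (q : MvPolynomial (Fin 3) ℝ) :
    spinBracket (X 0) q = X 2 * pderiv 1 q - X 1 * pderiv 2 q := by
  simp [spinBracket, pderiv_X]; ring

open MvPolynomial in
theorem spinBracket_X_one (q : MvPolynomial (Fin 3) ℝ) :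
    spinBracket (X 1) q = X 0 * pderiv 2 q - X 2 * pderiv 0 q := by
  simp [spinBracket, pderiv_X]; ring

open MvPolynomial in
theorem spinBracket_X_two (q : MvPolynomial (Fin 3) ℝ) :
    spinBracket (X 2) q = X 1 * pderiv 0 q - X 0 * pderiv 1 q := by
  simp [spinBracket, pderiv_X]; ring

/-- The real and imaginary parts of `(S₁ + i S₂) ^ k`. -/
noncomputable def sectorial : ℕ → MvPolynomial (Fin 3) ℝ × MvPolynomial (Fin 3) ℝ
  | 0 => (1, 0)
  | k + 1 => (MvPolynomial.X 0 * (sectorial k).1 - MvPolynomial.X 1 * (sectorial k).2,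
      MvPolynomial.X 0 * (sectorial k).2 + MvPolynomial.X 1 * (sectorial k).1)

/-- The real part of `(S₁ + i S₂) ^ k`. -/
noncomputable def sectorialRe (k : ℕ) : MvPolynomial (Fin 3) ℝ := (sectorial k).1

/-- The imaginary part of `(S₁ + i S₂) ^ k`. -/
noncomputable def sectorialIm (k : ℕ) : MvPolynomial (Fin 3) ℝ := (sectorial k).2

section Sectorial

open MvPolynomial

theorem sectorialRe_zero : sectorialRe 0 = 1 := rfl

theorem sectorialIm_zero : sectorialIm 0 = 0 := rfl

theorem sectorialRe_succ (k : ℕ) :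
    sectorialRe (k + 1) = X 0 * sectorialRe k - X 1 * sectorialIm k := rfl

theorem sectorialIm_succ (k : ℕ) :
    sectorialIm (k + 1) = X 0 * sectorialIm k + X 1 * sectorialRe k := rfl

theorem sectorial_add (m n : ℕ) :
    sectorialRe (m + n) = sectorialRe m * sectorialRe n - sectorialIm m * sectorialIm n ∧
    sectorialIm (m + n) = sectorialRe m * sectorialIm n + sectorialIm m * sectorialRe n := by
  induction n with
  | zero => simp [sectorialRe_zero, sectorialIm_zero]
  | succ n ih =>
    rw [← add_assoc, sectorialRe_succ, sectorialIm_succ, sectorialRe_succ, sectorialIm_succ,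
      ih.1, ih.2]
    constructor <;> ring

theorem sectorialRe_sq_add_sectorialIm_sq (k : ℕ) :
    sectorialRe k ^ 2 + sectorialIm k ^ 2 = (X 0 ^ 2 + X 1 ^ 2) ^ k := by
  induction k with
  | zero => simp [sectorialRe_zero, sectorialIm_zero]
  | succ k ih =>
    rw [sectorialRe_succ, sectorialIm_succ, pow_succ _ k, ← ih]
    ring

theorem pderiv_sectorial_succ (k : ℕ) :
    pderiv 0 (sectorialRe (k + 1)) = ((k : MvPolynomial (Fin 3) ℝ) + 1) * sectorialRe k ∧
    pderiv 0 (sectorialIm (k + 1)) = ((k : MvPolynomial (Fin 3) ℝ) + 1) * sectorialIm k ∧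
    pderiv 1 (sectorialRe (k + 1)) = -(((k : MvPolynomial (Fin 3) ℝ) + 1) * sectorialIm k) ∧
    pderiv 1 (sectorialIm (k + 1)) = ((k : MvPolynomial (Fin 3) ℝ) + 1) * sectorialRe k := by
  induction k with
  | zero =>
    simp [sectorialRe_succ, sectorialIm_succ, sectorialRe_zero, sectorialIm_zero, pderiv_X]
  | succ k ih =>
    obtain ⟨h1, h2, h3, h4⟩ := ih
    rw [sectorialRe_succ (k + 1), sectorialIm_succ (k + 1)]
    simp only [map_add, map_sub, Derivation.leibniz, smul_eq_mul, h1, h2, h3, h4, pderiv_X]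
    simp only [sectorialRe_succ k, sectorialIm_succ k]
    simp
    refine ⟨?_, ?_, ?_, ?_⟩ <;> ring

theorem pderiv_two_sectorial (k : ℕ) :
    pderiv 2 (sectorialRe k) = 0 ∧ pderiv 2 (sectorialIm k) = 0 := by
  induction k with
  | zero => simp [sectorialRe_zero, sectorialIm_zero]
  | succ k ih =>
    rw [sectorialRe_succ, sectorialIm_succ]
    simp [Derivation.leibniz, ih.1, ih.2, pderiv_X]

theorem cauchyRiemann_sectorial (k : ℕ) :
    pderiv 1 (sectorialRe k) = -pderiv 0 (sectorialIm k) ∧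
    pderiv 1 (sectorialIm k) = pderiv 0 (sectorialRe k) := by
  rcases k with - | k
  · simp [sectorialRe_zero, sectorialIm_zero]
  · obtain ⟨h1, h2, h3, h4⟩ := pderiv_sectorial_succ k
    rw [h1, h2, h3, h4]
    exact ⟨rfl, rfl⟩

theorem euler_sectorial (k : ℕ) :
    X 0 * pderiv 0 (sectorialRe k) - X 1 * pderiv 0 (sectorialIm k) =
      (k : MvPolynomial (Fin 3) ℝ) * sectorialRe k ∧
    X 0 * pderiv 0 (sectorialIm k) + X 1 * pderiv 0 (sectorialRe k) =
      (k : MvPolynomial (Fin 3) ℝ) * sectorialIm k := by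
  rcases k with - | k
  · simp [sectorialRe_zero, sectorialIm_zero]
  · obtain ⟨h1, h2, -, -⟩ := pderiv_sectorial_succ k
    rw [h1, h2, sectorialRe_succ, sectorialIm_succ]
    push_cast
    constructor <;> ring

/-- The real part of `(S₁ + i S₂) ^ a (p(S₃) + i q(S₃))`. -/
noncomputable def weightPoly (a : ℕ) (p q : Polynomial ℝ) : MvPolynomial (Fin 3) ℝ :=
  sectorialRe a * Polynomial.aeval (X 2) p - sectorialIm a * Polynomial.aeval (X 2) q

theorem pderiv_aeval_X_two (i : Fin 3) (p : Polynomial ℝ) :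
    pderiv i (Polynomial.aeval (X 2 : MvPolynomial (Fin 3) ℝ) p) =
      Polynomial.aeval (X 2 : MvPolynomial (Fin 3) ℝ) (Polynomial.derivative p) *
        pderiv i (X 2) := by
  rw [Derivation.map_aeval, smul_eq_mul]

/-- S₃ generates rotations about its axis, so its bracket multiplies zᵃ(p + iq) by −ia; (p, q) ↦ (q,
−p) is multiplication by −i. -/
theorem spinBracket_X_two_weightPoly (a : ℕ) (p q : Polynomial ℝ) :
    spinBracket (X 2) (weightPoly a p q) =
      (a : MvPolynomial (Fin 3) ℝ) * weightPoly a q (-p) := by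
  obtain ⟨e1, e2⟩ := euler_sectorial a
  obtain ⟨c1, c2⟩ := cauchyRiemann_sectorial a
  rw [spinBracket_X_two]
  simp only [weightPoly, map_sub, Derivation.leibniz, smul_eq_mul, pderiv_aeval_X_two, pderiv_X,
    c1, c2, map_neg]
  simp
  linear_combination Polynomial.aeval (X 2 : MvPolynomial (Fin 3) ℝ) p * e2 +
    Polynomial.aeval (X 2 : MvPolynomial (Fin 3) ℝ) q * e1

/-- Since {z, z} = 0 and {z, S₃} = iz, bracketing zᵃw(S₃) with z gives izᵃ⁺¹w′(S₃). This is the real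
part after multiplying by −i. -/
theorem weightPoly_succ_derivative (a : ℕ) (p q : Polynomial ℝ) :
    weightPoly (a + 1) (Polynomial.derivative p) (Polynomial.derivative q) =
      spinBracket (X 0) (weightPoly a q (-p)) + spinBracket (X 1) (weightPoly a p q) := by
  obtain ⟨c1, c2⟩ := cauchyRiemann_sectorial a
  obtain ⟨d1, d2⟩ := pderiv_two_sectorial a
  rw [spinBracket_X_zero, spinBracket_X_one]
  simp only [weightPoly, map_sub, Derivation.leibniz, smul_eq_mul, pderiv_aeval_X_two, pderiv_X,
    c1, c2, d1, d2, map_neg, sectorialRe_succ, sectorialIm_succ]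
  simp
  ring

theorem weightPoly_neg (a : ℕ) (p q : Polynomial ℝ) :
    weightPoly a (-p) (-q) = -weightPoly a p q := by
  simp only [weightPoly, map_neg]; ring

/-- `weightPoly` as a linear map. -/
noncomputable def weightMap (a : ℕ) :
    Polynomial ℝ × Polynomial ℝ →ₗ[ℝ] MvPolynomial (Fin 3) ℝ where
  toFun pq := weightPoly a pq.1 pq.2
  map_add' x y := by simp only [weightPoly, Prod.fst_add, Prod.snd_add, map_add]; ring
  map_smul' c x := by
    simp only [weightPoly, Prod.smul_fst, Prod.smul_snd, map_smul, RingHom.id_apply, smul_sub,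
      mul_smul_comm]

/-- Multiplication by S₁ or S₂ shifts the weight by ±1. The downward shift produces zz̄ = S₁² + S₂²,
which on the sphere is s² − S₃², a polynomial in S₃. -/
theorem iSup_range_weightMap_sup_sphereIdeal (s : ℝ) :
    (⨆ a, LinearMap.range (weightMap a)) ⊔ (sphereIdeal s).restrictScalars ℝ = ⊤ := by
  set N := (⨆ a, LinearMap.range (weightMap a)) ⊔ (sphereIdeal s).restrictScalars ℝ with hN
  have hw : ∀ a p q, weightPoly a p q ∈ N := fun a p q =>
    Submodule.mem_sup_left (Submodule.mem_iSup_of_mem a ⟨(p, q), rfl⟩)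
  have hu : ∀ a p q, (X 0 ^ 2 + X 1 ^ 2) * weightPoly a p q ∈ N := by
    intro a p q
    have h1 : (X 0 ^ 2 + X 1 ^ 2) * weightPoly a p q =
        weightPoly a ((Polynomial.C (s ^ 2) - Polynomial.X ^ 2) * p)
          ((Polynomial.C (s ^ 2) - Polynomial.X ^ 2) * q) +
        weightPoly a p q * sphereRelation s := by
      simp only [weightPoly, sphereRelation, map_mul, map_sub, map_pow, Polynomial.aeval_X,
        Polynomial.aeval_C, MvPolynomial.algebraMap_eq]
      ring
    rw [h1]
    exact N.add_mem (hw _ _ _) (Submodule.mem_sup_right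
      (Ideal.mul_mem_left _ _ (Ideal.subset_span rfl)))
  have hX : ∀ (i : Fin 3) (a : ℕ) (p q : Polynomial ℝ), X i * weightPoly a p q ∈ N := by
    intro i a p q
    fin_cases i
    · change X 0 * weightPoly a p q ∈ N
      rcases a with - | a
      · have h1 : X 0 * weightPoly 0 p q = weightPoly 1 p 0 := by
          simp [weightPoly, sectorialRe_succ, sectorialRe_zero, sectorialIm_zero]
        rw [h1]; exact hw _ _ _
      · have h1 : X 0 * weightPoly (a + 1) p q = (2⁻¹ : ℝ) • (weightPoly (a + 2) p q +
            (X 0 ^ 2 + X 1 ^ 2) * weightPoly a p q) := by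
          rw [eq_inv_smul_iff₀ two_ne_zero, two_smul]
          simp only [weightPoly, sectorialRe_succ, sectorialIm_succ]
          ring
        rw [h1]; exact N.smul_mem _ (N.add_mem (hw _ _ _) (hu _ _ _))
    · change X 1 * weightPoly a p q ∈ N
      rcases a with - | a
      · have h1 : X 1 * weightPoly 0 p q = weightPoly 1 0 (-p) := by
          simp [weightPoly, sectorialIm_succ, sectorialRe_zero, sectorialIm_zero]
        rw [h1]; exact hw _ _ _
      · have h1 : X 1 * weightPoly (a + 1) p q = (2⁻¹ : ℝ) • (weightPoly (a + 2) q (-p) -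
            (X 0 ^ 2 + X 1 ^ 2) * weightPoly a q (-p)) := by
          rw [eq_inv_smul_iff₀ two_ne_zero, two_smul]
          simp only [weightPoly, sectorialRe_succ, sectorialIm_succ, map_neg]
          ring
        rw [h1]; exact N.smul_mem _ (N.sub_mem (hw _ _ _) (hu _ _ _))
    · change X 2 * weightPoly a p q ∈ N
      have h1 : X 2 * weightPoly a p q =
          weightPoly a (Polynomial.X * p) (Polynomial.X * q) := by
        simp only [weightPoly, map_mul, Polynomial.aeval_X]
        ring
      rw [h1]; exact hw _ _ _
  have hmul : ∀ i : Fin 3, N ≤ N.comap (LinearMap.mulLeft ℝ (X i)) := by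
    intro i
    refine sup_le (iSup_le fun a => ?_) fun r hr => ?_
    · rintro _ ⟨⟨p, q⟩, rfl⟩
      exact hX i a p q
    · exact Submodule.mem_sup_right (Ideal.mul_mem_left _ _ hr)
  refine Submodule.eq_top_iff'.2 fun p => ?_
  induction p using MvPolynomial.induction_on with
  | C c =>
    have h1 : (C c : MvPolynomial (Fin 3) ℝ) = weightPoly 0 (Polynomial.C c) 0 := by
      simp [weightPoly, sectorialRe_zero, sectorialIm_zero, MvPolynomial.algebraMap_eq]
    rw [h1]; exact hw _ _ _
  | add p q hp hq => exact N.add_mem hp hq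
  | mul_X p i hp => rw [mul_comm]; exact hmul i hp

/-- S₃ times the Jacobian of the holomorphic map zᵏ⁺¹, which is |(k+1)zᵏ|². -/
theorem spinBracket_sectorialRe_sectorialIm (k : ℕ) :
    spinBracket (sectorialRe (k + 1)) (sectorialIm (k + 1)) =
      (((k : ℝ) + 1) ^ 2) • (X 2 * (X 0 ^ 2 + X 1 ^ 2) ^ k) := by
  obtain ⟨h1, h2, h3, h4⟩ := pderiv_sectorial_succ k
  obtain ⟨d1, d2⟩ := pderiv_two_sectorial (k + 1)
  rw [← sectorialRe_sq_add_sectorialIm_sq, MvPolynomial.smul_eq_C_mul]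
  simp only [spinBracket, h1, h2, h3, h4, d1, d2, map_pow, map_add, map_natCast, map_one]
  ring

theorem spinBracket_X_zero_sectorial (k : ℕ) :
    spinBracket (X 0) (sectorialRe (k + 1)) = -((k : ℝ) + 1) • (X 2 * sectorialIm k) ∧
    spinBracket (X 0) (sectorialIm (k + 1)) = ((k : ℝ) + 1) • (X 2 * sectorialRe k) := by
  obtain ⟨h1, h2, h3, h4⟩ := pderiv_sectorial_succ k
  obtain ⟨d1, d2⟩ := pderiv_two_sectorial (k + 1)
  simp only [spinBracket_X_zero, h3, h4, d1, d2, MvPolynomial.smul_eq_C_mul, map_neg, map_add,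
    map_natCast, map_one]
  constructor <;> ring

/-- Real and imaginary parts of {zᵏ⁺¹, S₃zᵏ} = i(k+1)z²ᵏ⁺¹. -/
theorem spinBracket_sectorial_doubling (k : ℕ) :
    spinBracket (sectorialRe (k + 1)) (X 2 * sectorialRe k) -
        spinBracket (sectorialIm (k + 1)) (X 2 * sectorialIm k) =
      -((k : ℝ) + 1) • sectorialIm (k + 1 + k) ∧
    spinBracket (sectorialRe (k + 1)) (X 2 * sectorialIm k) +
        spinBracket (sectorialIm (k + 1)) (X 2 * sectorialRe k) =
      ((k : ℝ) + 1) • sectorialRe (k + 1 + k) := by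
  obtain ⟨h1, h2, h3, h4⟩ := pderiv_sectorial_succ k
  obtain ⟨d1, d2⟩ := pderiv_two_sectorial (k + 1)
  obtain ⟨d3, d4⟩ := pderiv_two_sectorial k
  obtain ⟨c1, c2⟩ := cauchyRiemann_sectorial k
  rw [(sectorial_add (k + 1) k).1, (sectorial_add (k + 1) k).2]
  simp only [spinBracket, Derivation.leibniz, smul_eq_mul, h1, h2, h3, h4, d1, d2, d3, d4, c1, c2,
    pderiv_X, MvPolynomial.smul_eq_C_mul, map_neg, map_add, map_natCast, map_one]
  simp
  simp only [sectorialRe_succ, sectorialIm_succ]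
  constructor <;> ring

theorem spinBracket_X_two_sectorial (k : ℕ) :
    spinBracket (X 2) (sectorialRe k) = (k : ℝ) • sectorialIm k ∧
    spinBracket (X 2) (sectorialIm k) = -(k : ℝ) • sectorialRe k := by
  obtain ⟨e1, e2⟩ := euler_sectorial k
  obtain ⟨c1, c2⟩ := cauchyRiemann_sectorial k
  simp only [spinBracket_X_two, c1, c2, MvPolynomial.smul_eq_C_mul, map_neg, map_natCast]
  constructor
  · linear_combination e2
  · linear_combination -e1

/-- On homogeneous polynomials of degree d, the sum of the squared brackets is −d(d+1) + r²Δ, with Δ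
the flat Laplacian. Here d = 2n + 3, and Δ lowers the power of S₁² + S₂² by one. -/
theorem casimir_X_two_mul_pow (n : ℕ) :
    spinBracket (X 0) (spinBracket (X 0) (X 2 * (X 0 ^ 2 + X 1 ^ 2) ^ (n + 1))) +
      spinBracket (X 1) (spinBracket (X 1) (X 2 * (X 0 ^ 2 + X 1 ^ 2) ^ (n + 1))) +
      spinBracket (X 2) (spinBracket (X 2) (X 2 * (X 0 ^ 2 + X 1 ^ 2) ^ (n + 1))) =
    -(((2 * (n : ℝ) + 3) * (2 * n + 4)) • (X 2 * (X 0 ^ 2 + X 1 ^ 2) ^ (n + 1))) +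
      (4 * ((n : ℝ) + 1) ^ 2) • ((X 0 ^ 2 + X 1 ^ 2 + X 2 ^ 2) *
        (X 2 * (X 0 ^ 2 + X 1 ^ 2) ^ n)) := by
  set u : MvPolynomial (Fin 3) ℝ := X 0 ^ 2 + X 1 ^ 2 with hu
  have hu0 : pderiv 0 u = 2 * X 0 := by simp [hu, pderiv_X]
  have hu1 : pderiv 1 u = 2 * X 1 := by simp [hu, pderiv_X]
  have hu2 : pderiv 2 u = 0 := by simp [hu, pderiv_X]
  have hpow : ∀ i, pderiv i (u ^ (n + 1)) =
      ((n : MvPolynomial (Fin 3) ℝ) + 1) * u ^ n * pderiv i u := by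
    intro i
    rw [Derivation.leibniz_pow]
    simp only [smul_eq_mul, nsmul_eq_mul, add_tsub_cancel_right]
    push_cast
    ring
  have heuler : X 0 * pderiv 0 (u ^ n) + X 1 * pderiv 1 (u ^ n) =
      2 * (n : MvPolynomial (Fin 3) ℝ) * u ^ n := by
    rw [Derivation.leibniz_pow, Derivation.leibniz_pow, hu0, hu1]
    rcases n with - | n
    · simp
    · simp only [smul_eq_mul, nsmul_eq_mul, add_tsub_cancel_right, hu]
      ring
  have hv2 : pderiv 2 (u ^ n) = 0 := by rw [Derivation.leibniz_pow, hu2]; simp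
  have hc : ∀ i, pderiv i (n : MvPolynomial (Fin 3) ℝ) = 0 := fun i => by
    rw [← map_natCast (C : ℝ →+* MvPolynomial (Fin 3) ℝ), pderiv_C]
  have hc2 : ∀ i, pderiv i (2 : MvPolynomial (Fin 3) ℝ) = 0 := fun i => by
    rw [← map_ofNat (C : ℝ →+* MvPolynomial (Fin 3) ℝ), pderiv_C]
  have f0 : spinBracket (X 0) (X 2 * u ^ (n + 1)) =
      u ^ n * (X 1 * (2 * ((n : MvPolynomial (Fin 3) ℝ) + 1) * (X 2 * X 2) - u)) := by
    rw [spinBracket_X_zero, Derivation.leibniz, Derivation.leibniz, hpow, hpow, hu1, hu2, pow_succ]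
    simp [pderiv_X]
    ring
  have f1 : spinBracket (X 1) (X 2 * u ^ (n + 1)) =
      u ^ n * (X 0 * (u - 2 * ((n : MvPolynomial (Fin 3) ℝ) + 1) * (X 2 * X 2))) := by
    rw [spinBracket_X_one, Derivation.leibniz, Derivation.leibniz, hpow, hpow, hu0, hu2, pow_succ]
    simp [pderiv_X]
    ring
  have f2 : spinBracket (X 2) (X 2 * u ^ (n + 1)) = 0 := by
    rw [spinBracket_X_two, Derivation.leibniz, Derivation.leibniz, hpow, hpow, hu0, hu1]
    simp [pderiv_X]
    ring
  have f3 : spinBracket (X 2) 0 = 0 := by simp [spinBracket]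
  rw [f0, f1, f2, f3, spinBracket_X_zero, spinBracket_X_one, pow_succ]
  clear f0 f1 f2 f3 hpow
  generalize u ^ n = v at *
  simp only [Derivation.leibniz, smul_eq_mul, map_sub, map_add, hu0, hu1, hu2, hv2, hc, hc2,
    pderiv_X, MvPolynomial.smul_eq_C_mul, map_mul, map_natCast, map_ofNat, map_one, map_pow]
  simp
  linear_combination (X 2 * (2 * ((n : MvPolynomial (Fin 3) ℝ) + 1) * (X 2 * X 2) - u)) * heuler

end Sectorial

theorem Submodule.mem_of_sum_mem_of_eigenvectors {𝕜 V ι : Type*} [Field 𝕜] [AddCommGroup V]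
    [Module 𝕜 V] {T : Module.End 𝕜 V} {C : Submodule 𝕜 V} (hC : ∀ v ∈ C, T v ∈ C) {μ : ι → 𝕜}
    (hμ : Function.Injective μ) (σ : Finset ι) {f : ι → V} (hf : ∀ a, T (f a) = μ a • f a)
    (hsum : ∑ a ∈ σ, f a ∈ C) : ∀ a ∈ σ, f a ∈ C := by
  classical
  induction σ using Finset.induction_on generalizing f with
  | empty => simp
  | insert b σ hb ih =>
    have h1 : ∑ a ∈ σ, (μ a - μ b) • f a ∈ C := by
      have h2 := C.sub_mem (hC _ hsum) (C.smul_mem (μ b) hsum)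
      rw [Finset.sum_insert hb, map_add, map_sum, hf, smul_add, add_sub_add_left_eq_sub,
        Finset.smul_sum, ← Finset.sum_sub_distrib] at h2
      simpa only [hf, ← sub_smul] using h2
    have h2 := ih (f := fun a => (μ a - μ b) • f a)
      (fun a => by rw [map_smul, hf, smul_comm]) h1
    have h3 : ∀ a ∈ σ, f a ∈ C := by
      intro a ha
      have hne : μ a - μ b ≠ 0 := sub_ne_zero.2 fun h => hb (hμ h ▸ ha)
      exact (C.smul_mem_iff hne).1 (h2 a ha)
    rw [Finset.sum_insert hb] at hsum
    intro a ha
    rcases Finset.mem_insert.1 ha with rfl | ha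
    · exact (C.add_mem_iff_left (C.sum_mem h3)).1 hsum
    · exact h3 a ha

/-! ### Poisson subalgebras strictly larger than P¹ -/

namespace SpherePoly

open MvPolynomial

variable {s : ℝ}

theorem one_mem_P1 : (1 : SpherePoly s) ∈ P1 s :=
  ⟨1, by simp [MvPolynomial.mem_restrictTotalDegree], rfl⟩

theorem spin_mem_P1 (i : Fin 3) : spin s i ∈ P1 s :=
  ⟨X i, by simp [MvPolynomial.mem_restrictTotalDegree], rfl⟩

theorem mk_C (c : ℝ) : mk s (C c) = c • 1 := by
  rw [← mul_one (C c), ← MvPolynomial.smul_eq_C_mul, map_smul]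
  rfl

theorem spin_lie_mk (i : Fin 3) (p : MvPolynomial (Fin 3) ℝ) :
    ⁅spin s i, mk s p⁆ = mk s (spinBracket (X i) p) := rfl

theorem exists_mk_eq_of_degree_le_one {p : MvPolynomial (Fin 3) ℝ}
    (hp : p ∈ restrictTotalDegree (Fin 3) ℝ 1) :
    ∃ (c : ℝ) (a : Fin 3 → ℝ), mk s p = c • 1 + ∑ i, a i • spin s i := by
  rw [mem_restrictTotalDegree] at hp
  rw [p.as_sum, map_sum]
  refine Finset.sum_induction _ (fun f => ∃ (c : ℝ) (a : Fin 3 → ℝ),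
    f = c • (1 : SpherePoly s) + ∑ i, a i • spin s i) ?_ ⟨0, 0, by simp⟩ fun m hm => ?_
  · rintro _ _ ⟨c, a, rfl⟩ ⟨d, b, rfl⟩
    refine ⟨c + d, a + b, ?_⟩
    simp only [Pi.add_apply, add_smul, Finset.sum_add_distrib]
    abel
  · have hdeg : m.degree ≤ 1 := (le_totalDegree hm).trans hp
    rcases Nat.le_one_iff_eq_zero_or_eq_one.1 hdeg with h0 | h1
    · obtain rfl : m = 0 := (Finsupp.degree_eq_zero_iff m).1 h0
      refine ⟨coeff 0 p, 0, ?_⟩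
      rw [monomial_zero', mk_C]
      simp
    · obtain ⟨i, rfl⟩ : ∃ i, m = Finsupp.single i 1 :=
        (Finsupp.sum_eq_one_iff m).1 h1
      refine ⟨0, Pi.single i (coeff (Finsupp.single i 1) p), ?_⟩
      rw [zero_smul, zero_add, Finset.sum_eq_single i (fun j _ hj => by
        rw [Pi.single_eq_of_ne hj, zero_smul]) (by simp), Pi.single_eq_same]
      rw [spin, ← map_smul, MvPolynomial.smul_eq_C_mul, C_mul_X_eq_monomial]

theorem mk_weightPoly_mem_P1 {a n : ℕ} {p q : Polynomial ℝ} (hp : p.natDegree ≤ n)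
    (hq : q.natDegree ≤ n) (han : a + n ≤ 1) : mk s (weightPoly a p q) ∈ P1 s := by
  have hC : ∀ c : ℝ, mk s (C c) ∈ P1 s := fun c => by
    rw [mk_C]; exact (P1 s).smul_mem _ one_mem_P1
  have hX : ∀ (c : ℝ) (i : Fin 3), mk s (c • X i) ∈ P1 s := fun c i => by
    rw [map_smul]; exact (P1 s).smul_mem _ (spin_mem_P1 i)
  rcases a with - | a
  · have h1 : weightPoly 0 p q = p.coeff 1 • X 2 + C (p.coeff 0) := by
      rw [Polynomial.eq_X_add_C_of_natDegree_le_one (hp.trans (by omega))]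
      simp [weightPoly, sectorialRe_zero, sectorialIm_zero, MvPolynomial.algebraMap_eq,
        MvPolynomial.smul_eq_C_mul]
    rw [h1, map_add]
    exact (P1 s).add_mem (hX _ _) (hC _)
  · obtain rfl : a = 0 := by omega
    obtain rfl : n = 0 := by omega
    have h1 : weightPoly (0 + 1) p q = p.coeff 0 • X 0 - q.coeff 0 • X 1 := by
      rw [Polynomial.eq_C_of_natDegree_le_zero hp, Polynomial.eq_C_of_natDegree_le_zero hq]
      simp [weightPoly, sectorialRe_succ, sectorialIm_succ, sectorialRe_zero, sectorialIm_zero,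
        MvPolynomial.algebraMap_eq, MvPolynomial.smul_eq_C_mul, mul_comm]
    rw [h1, map_sub]
    exact (P1 s).sub_mem (hX _ _) (hX _ _)

variable {C : LieSubalgebra ℝ (SpherePoly s)}

/-- Raising n times differentiates p + iq down to a nonzero complex constant times zᵃ⁺ⁿ. Both real
and imaginary parts are carried along so that this constant can be divided out. -/
theorem exists_sectorial_mem_of_weightPoly_mem (hC : P1 s ≤ C) {n a : ℕ} {p q : Polynomial ℝ}
    (hp : p.natDegree ≤ n) (hq : q.natDegree ≤ n) (hn : p.coeff n ≠ 0 ∨ q.coeff n ≠ 0)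
    (h1 : mk s (weightPoly a p q) ∈ C) (h2 : mk s (weightPoly a q (-p)) ∈ C) :
    mk s (sectorialRe (a + n)) ∈ C ∧ mk s (sectorialIm (a + n)) ∈ C := by
  induction n generalizing a p q with
  | zero =>
    set c := p.coeff 0 with hc
    set d := q.coeff 0 with hd
    have e1 : weightPoly a p q = c • sectorialRe a - d • sectorialIm a := by
      rw [Polynomial.eq_C_of_natDegree_le_zero hp, Polynomial.eq_C_of_natDegree_le_zero hq]
      simp [weightPoly, MvPolynomial.algebraMap_eq, MvPolynomial.smul_eq_C_mul, mul_comm, c, d]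
    have e2 : weightPoly a q (-p) = d • sectorialRe a + c • sectorialIm a := by
      rw [Polynomial.eq_C_of_natDegree_le_zero hp, Polynomial.eq_C_of_natDegree_le_zero hq]
      simp [weightPoly, MvPolynomial.algebraMap_eq, MvPolynomial.smul_eq_C_mul, mul_comm, c, d]
    have hcd : c ^ 2 + d ^ 2 ≠ 0 := by
      rcases hn with h | h <;> positivity
    rw [e1, map_sub, map_smul, map_smul] at h1
    rw [e2, map_add, map_smul, map_smul] at h2
    constructor
    · refine (C.toSubmodule.smul_mem_iff hcd).1 ?_
      have := C.add_mem (C.smul_mem c h1) (C.smul_mem d h2)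
      rw [add_zero]
      change _ ∈ C
      convert this using 1
      module
    · refine (C.toSubmodule.smul_mem_iff hcd).1 ?_
      have := C.sub_mem (C.smul_mem c h2) (C.smul_mem d h1)
      rw [add_zero]
      change _ ∈ C
      convert this using 1
      module
  | succ n ih =>
    have hder : ∀ {r : Polynomial ℝ}, r.natDegree ≤ n + 1 →
        (Polynomial.derivative r).natDegree ≤ n := fun {r} hr => by
      have := Polynomial.natDegree_derivative_le r
      omega
    have hcoeff : ∀ {r : Polynomial ℝ}, r.coeff (n + 1) ≠ 0 →
        (Polynomial.derivative r).coeff n ≠ 0 := fun {r} hr => by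
      rw [Polynomial.coeff_derivative]
      exact mul_ne_zero hr (by positivity)
    have hlie : ∀ (i : Fin 3) (r : MvPolynomial (Fin 3) ℝ), mk s r ∈ C →
        mk s (spinBracket (X i) r) ∈ C := fun i r hr => by
      rw [← spin_lie_mk]
      exact C.lie_mem (hC (spin_mem_P1 i)) hr
    have := ih (a := a + 1) (p := Polynomial.derivative p) (q := Polynomial.derivative q)
      (hder hp) (hder hq) (hn.imp hcoeff hcoeff) (by
        rw [weightPoly_succ_derivative, map_add]
        exact C.add_mem (hlie _ _ h2) (hlie _ _ h1))
      (by
        rw [← map_neg, weightPoly_succ_derivative, weightPoly_neg, map_add]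
        refine C.add_mem (hlie _ _ ?_) (hlie _ _ h2)
        rw [map_neg]
        exact C.neg_mem h1)
    rwa [show a + (n + 1) = a + 1 + n by ring]

theorem exists_two_le_sectorial_mem (hC : P1 s < C) :
    ∃ k, 2 ≤ k ∧ mk s (sectorialRe k) ∈ C ∧ mk s (sectorialIm k) ∈ C := by
  obtain ⟨f, hfC, hfP⟩ := SetLike.exists_of_lt hC
  have hdec : f ∈ ⨆ a, LinearMap.range ((mk s) ∘ₗ weightMap a) := by
    obtain ⟨r, rfl⟩ := mk_surjective s f
    have hr : r ∈ (⨆ a, LinearMap.range (weightMap a)) ⊔ (sphereIdeal s).restrictScalars ℝ := by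
      rw [iSup_range_weightMap_sup_sphereIdeal]; exact Submodule.mem_top
    obtain ⟨g, hg, i, hi, rfl⟩ := Submodule.mem_sup.1 hr
    have h1 : mk s (g + i) = mk s g := mk_eq_mk_iff.2 (by simpa using hi)
    rw [h1]
    simp only [LinearMap.range_comp, ← Submodule.map_iSup]
    exact Submodule.mem_map_of_mem hg
  obtain ⟨σ, hσ, rfl⟩ := (Submodule.mem_iSup_iff_exists_finsupp _ _).1 hdec
  choose g hg using hσ
  have hg' : ∀ a, mk s (weightPoly a (g a).1 (g a).2) = σ a := hg
  let T : Module.End ℝ (SpherePoly s) := LieAlgebra.ad ℝ _ (spin s 2)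
  have hT : ∀ a p q, T (mk s (weightPoly a p q)) = (a : ℝ) • mk s (weightPoly a q (-p)) := by
    intro a p q
    change ⁅spin s 2, mk s (weightPoly a p q)⁆ = _
    rw [spin_lie_mk, spinBracket_X_two_weightPoly, ← map_smul, MvPolynomial.smul_eq_C_mul,
      map_natCast]
  have hTC : ∀ v ∈ C.toSubmodule, T v ∈ C.toSubmodule := fun v hv =>
    C.lie_mem (hC.le (spin_mem_P1 2)) hv
  have hmem : ∀ a ∈ σ.support, σ a ∈ C := by
    -- The bracket with S₃ rotates real into imaginary parts; only its square acts by real scalars,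
    -- −a², distinct for distinct a ≥ 0.
    refine Submodule.mem_of_sum_mem_of_eigenvectors (T := T * T) (C := C.toSubmodule)
      (μ := fun a : ℕ => -((a : ℝ) ^ 2)) (fun v hv => hTC _ (hTC v hv)) ?_ _ ?_ hfC
    · intro a b hab
      have h1 : (a : ℝ) ^ 2 = (b : ℝ) ^ 2 := neg_injective hab
      exact_mod_cast (pow_left_inj₀ (Nat.cast_nonneg a) (Nat.cast_nonneg b) two_ne_zero).1 h1
    · intro a
      rw [← hg', Module.End.mul_apply, hT, map_smul, hT, weightPoly_neg, map_neg]
      module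
  obtain ⟨a, ha, haP⟩ : ∃ a ∈ σ.support, σ a ∉ P1 s := by
    by_contra! h
    exact hfP ((P1 s).toSubmodule.sum_mem h)
  have h1 := hmem a ha
  rw [← hg'] at h1 haP
  obtain ⟨p, q, hU, hV, hP⟩ : ∃ p q, mk s (weightPoly a p q) ∈ C ∧
      mk s (weightPoly a q (-p)) ∈ C ∧ mk s (weightPoly a p q) ∉ P1 s := by
    -- In weight 0 the bracket with S₃ gives nothing, but there q does not contribute and may be
    -- replaced by 0.
    rcases Nat.eq_zero_or_pos a with rfl | hapos
    · have e1 : weightPoly 0 (g 0).1 0 = weightPoly 0 (g 0).1 (g 0).2 := by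
        simp [weightPoly, sectorialIm_zero]
      refine ⟨(g 0).1, 0, e1 ▸ h1, ?_, e1 ▸ haP⟩
      have e2 : weightPoly 0 0 (-(g 0).1) = 0 := by simp [weightPoly, sectorialIm_zero]
      rw [e2, map_zero]
      exact C.zero_mem
    · refine ⟨_, _, h1, ?_, haP⟩
      have h2 := hTC _ h1
      rw [hT] at h2
      exact (C.toSubmodule.smul_mem_iff (by positivity)).1 h2
  set n := max p.natDegree q.natDegree with hn
  have han : 2 ≤ a + n := by
    by_contra! h
    exact hP (mk_weightPoly_mem_P1 (le_max_left _ _) (le_max_right _ _) (by omega))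
  refine ⟨a + n, han, exists_sectorial_mem_of_weightPoly_mem hC.le (le_max_left _ _)
    (le_max_right _ _) ?_ hU hV⟩
  by_contra! h
  have key : ∀ r t : Polynomial ℝ, r.natDegree ≤ t.natDegree → r.coeff t.natDegree = 0 →
      t.coeff t.natDegree = 0 → r = 0 ∧ t = 0 := by
    intro r t hrt hr ht
    obtain rfl : t = 0 := Polynomial.leadingCoeff_eq_zero.1 ht
    rw [Polynomial.natDegree_zero] at hr hrt
    exact ⟨by rw [Polynomial.eq_C_of_natDegree_le_zero hrt, hr, map_zero], rfl⟩
  have hpq : p = 0 ∧ q = 0 := by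
    rcases le_total p.natDegree q.natDegree with hle | hle
    · rw [hn, max_eq_right hle] at h
      exact key p q hle h.1 h.2
    · rw [hn, max_eq_left hle] at h
      exact (key q p hle h.2 h.1).symm
  refine hP ?_
  have h0 : weightPoly a p q = 0 := by simp [weightPoly, hpq.1, hpq.2]
  rw [h0, map_zero]
  exact (P1 s).zero_mem

theorem sectorial_mem_doubling (hC : P1 s ≤ C) {k : ℕ} (h1 : mk s (sectorialRe (k + 1)) ∈ C)
    (h2 : mk s (sectorialIm (k + 1)) ∈ C) :
    mk s (sectorialRe (k + 1 + k)) ∈ C ∧ mk s (sectorialIm (k + 1 + k)) ∈ C := by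
  have hk : (k : ℝ) + 1 ≠ 0 := by positivity
  have hk' : -((k : ℝ) + 1) ≠ 0 := neg_ne_zero.2 hk
  have h3 : mk s (X 2 * sectorialIm k) ∈ C := by
    refine (C.toSubmodule.smul_mem_iff hk').1 ?_
    rw [← map_smul, ← (spinBracket_X_zero_sectorial k).1]
    exact C.lie_mem (hC (spin_mem_P1 0)) h1
  have h4 : mk s (X 2 * sectorialRe k) ∈ C := by
    refine (C.toSubmodule.smul_mem_iff hk).1 ?_
    rw [← map_smul, ← (spinBracket_X_zero_sectorial k).2]
    exact C.lie_mem (hC (spin_mem_P1 0)) h2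
  constructor
  · refine (C.toSubmodule.smul_mem_iff hk).1 ?_
    rw [← map_smul, ← (spinBracket_sectorial_doubling k).2, map_add]
    exact C.add_mem (C.lie_mem h1 h3) (C.lie_mem h2 h4)
  · refine (C.toSubmodule.smul_mem_iff hk').1 ?_
    rw [← map_smul, ← (spinBracket_sectorial_doubling k).1, map_sub]
    exact C.sub_mem (C.lie_mem h1 h4) (C.lie_mem h2 h3)

theorem exists_le_sectorial_mem (hC : P1 s < C) (N : ℕ) :
    ∃ k, N + 2 ≤ k ∧ mk s (sectorialRe k) ∈ C ∧ mk s (sectorialIm k) ∈ C := by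
  induction N with
  | zero => exact exists_two_le_sectorial_mem hC
  | succ N ih =>
    obtain ⟨k, hk, h1, h2⟩ := ih
    obtain ⟨j, rfl⟩ : ∃ j, k = j + 1 := ⟨k - 1, by omega⟩
    -- As j ≥ 1, the exponent 2j + 1 exceeds j + 1.
    exact ⟨j + 1 + j, by omega, sectorial_mem_doubling hC.le h1 h2⟩

/-- The Casimir on functions lowers the power by one, up to a factor proportional to s², which s > 0
allows to divide out. -/
theorem spin_two_mem_of_mul_pow_mem (hs : 0 < s) {K : Submodule ℝ (SpherePoly s)}
    (hK : ∀ i, ∀ f ∈ K, ⁅spin s i, f⁆ ∈ K) {n : ℕ}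
    (hn : mk s (X 2 * (X 0 ^ 2 + X 1 ^ 2) ^ n) ∈ K) : spin s 2 ∈ K := by
  induction n with
  | zero => simpa [spin] using hn
  | succ n ih =>
    refine ih ?_
    have hne : 4 * ((n : ℝ) + 1) ^ 2 * s ^ 2 ≠ 0 := by positivity
    refine (K.smul_mem_iff hne).1 ?_
    have h1 := congrArg (mk s) (casimir_X_two_mul_pow n)
    have h2 : mk s ((X 0 ^ 2 + X 1 ^ 2 + X 2 ^ 2) * (X 2 * (X 0 ^ 2 + X 1 ^ 2) ^ n)) =
        s ^ 2 • mk s (X 2 * (X 0 ^ 2 + X 1 ^ 2) ^ n) := by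
      rw [← map_smul, mk_eq_mk_iff, MvPolynomial.smul_eq_C_mul, ← sub_mul]
      exact Ideal.mul_mem_right _ _ (Ideal.subset_span rfl)
    simp only [map_add, map_neg, map_smul, h2] at h1
    rw [mul_smul, ← sub_eq_iff_eq_add'.2 h1]
    have h3 : ∀ i, mk s (spinBracket (X i) (spinBracket (X i)
        (X 2 * (X 0 ^ 2 + X 1 ^ 2) ^ (n + 1)))) ∈ K := fun i => hK i _ (hK i _ hn)
    exact K.sub_mem (K.add_mem (K.add_mem (h3 0) (h3 1)) (h3 2)) (K.neg_mem (K.smul_mem _ hn))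

end SpherePoly

/-! ### Quantizations of larger subalgebras annihilate the spin -/

namespace Quantization

open MvPolynomial SpherePoly

variable {s : ℝ} {C : LieSubalgebra ℝ (SpherePoly s)} {H : Type*}
  [NormedAddCommGroup H] [InnerProductSpace ℂ H] [CompleteSpace H]

theorem isSymmetric_op (Q : Quantization C H) (f : C) : (Q.op f).IsSymmetric := by
  intro v w
  set A := (operatorOn (Q.op f)).closure with hA
  have hsa : A.adjoint = A := Q.essentially_selfAdjoint f
  have hle : operatorOn (Q.op f) ≤ A := LinearPMap.le_closure _
  have hdense : Dense (A.domain : Set H) := (Q.essentially_selfAdjoint f).dense_domain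
  have hform : A.IsFormalAdjoint A := by
    have := A.adjoint_isFormalAdjoint hdense
    rwa [hsa] at this
  have hval : ∀ x : Q.domain, A ⟨x, hle.1 x.2⟩ = (Q.op f x : H) := fun x =>
    (hle.2 (x := x) (y := ⟨x, hle.1 x.2⟩) rfl).symm
  have := hform ⟨v, hle.1 v.2⟩ ⟨w, hle.1 w.2⟩
  rwa [hval, hval] at this

theorem op_mul_op (Q : Quantization C H) (f g : C) :
    Q.op f * Q.op g = Q.op g * Q.op f + Complex.I • Q.op ⁅f, g⁆ := by
  rw [Q.op_bracket, smul_smul, mul_neg, Complex.I_mul_I, neg_neg, one_smul]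
  abel

theorem isSpinTriple (Q : Quantization C H) (hC : P1 s ≤ C) :
    IsSpinTriple (Q.op ⟨spin s 0, hC (spin_mem_P1 0)⟩) (Q.op ⟨spin s 1, hC (spin_mem_P1 1)⟩)
      (Q.op ⟨spin s 2, hC (spin_mem_P1 2)⟩) where
  symm₁ := Q.isSymmetric_op _
  symm₂ := Q.isSymmetric_op _
  symm₃ := Q.isSymmetric_op _
  comm₁₂ := by
    rw [op_mul_op]
    congr 3
    refine Subtype.ext ?_
    change SpherePoly.mk s (spinBracket (X 0) (X 1)) = SpherePoly.mk s (X 2)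
    rw [spinBracket_X_zero]
    simp [pderiv_X]
  comm₂₃ := by
    rw [op_mul_op]
    congr 3
    refine Subtype.ext ?_
    change SpherePoly.mk s (spinBracket (X 1) (X 2)) = SpherePoly.mk s (X 0)
    rw [spinBracket_X_one]
    simp [pderiv_X]
  comm₃₁ := by
    rw [op_mul_op]
    congr 3
    refine Subtype.ext ?_
    change SpherePoly.mk s (spinBracket (X 2) (X 0)) = SpherePoly.mk s (X 1)
    rw [spinBracket_X_two]
    simp [pderiv_X]

theorem op_mem_of_spin_mem (Q : Quantization C H) (hC : P1 s ≤ C) {W : Submodule ℂ Q.domain}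
    (hW : ∀ i : Fin 3, ∀ v ∈ W, Q.op ⟨spin s i, hC (spin_mem_P1 i)⟩ v ∈ W) {f : C}
    (hf : (f : SpherePoly s) ∈ P1 s) {v : Q.domain} (hv : v ∈ W) : Q.op f v ∈ W := by
  have hreal : ∀ (c : ℝ) {w : Q.domain}, w ∈ W → c • w ∈ W := fun c w hw => by
    rw [← Complex.coe_smul]; exact W.smul_mem _ hw
  obtain ⟨f, hfC⟩ := f
  obtain ⟨p, hp, rfl⟩ := hf
  obtain ⟨c, a, hca⟩ := exists_mk_eq_of_degree_le_one (s := s) hp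
  have h1 : (⟨SpherePoly.mk s p, hfC⟩ : C) = c • ⟨1, hC one_mem_P1⟩ +
      ∑ i, a i • ⟨spin s i, hC (spin_mem_P1 i)⟩ := by
    refine Subtype.ext (hca.trans ?_)
    simp
  rw [h1, map_add, map_smul, Q.op_one, map_sum]
  simp only [map_smul, LinearMap.add_apply, LinearMap.smul_apply, LinearMap.sum_apply,
    Module.End.one_apply]
  exact W.add_mem (hreal _ hv) (W.sum_mem fun i _ => hreal _ (hW i v hv))

theorem finiteDimensional_domain (Q : Quantization C H) (hC : P1 s ≤ C)
    (hirr : Q.IsIrreducibleOn (P1 s)) : FiniteDimensional ℂ Q.domain := by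
  obtain ⟨hH, hirr⟩ := hirr
  refine (domain_eq_top_and_finiteDimensional (Q.isSpinTriple hC) ?_ fun W hW => ?_).2
  · intro h0
    have h1 := Q.dense_domain.closure_eq
    rw [h0, Submodule.bot_coe, closure_singleton] at h1
    obtain ⟨x, hx⟩ := exists_ne (0 : H)
    exact hx (by simpa using h1.symm.subset (Set.mem_univ x))
  · have hW' : ∀ i : Fin 3, ∀ v ∈ W, Q.op ⟨spin s i, hC (spin_mem_P1 i)⟩ v ∈ W := by
      intro i v hv
      fin_cases i
      exacts [(hW v hv).1, (hW v hv).2.1, (hW v hv).2.2]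
    refine (hirr (W.map Q.domain.subtype) (Submodule.map_subtype_le _ _) ?_).imp_left fun h => ?_
    · rintro f hf v ⟨w, hw, hwv⟩
      obtain rfl : w = v := Subtype.ext hwv
      exact ⟨_, Q.op_mem_of_spin_mem hC hW' hf hw, rfl⟩
    · exact Submodule.map_injective_of_injective Q.domain.injective_subtype
        (h.trans (Submodule.map_bot _).symm)

/-- The commutator with Q(S₃) on the finite dimensional endomorphism space has bounded spectrum,
while A ± iB would be eigenvectors with eigenvalues ±k. -/
theorem exists_op_sectorial_eq_zero (Q : Quantization C H) (hC : P1 s ≤ C)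
    [FiniteDimensional ℂ Q.domain] : ∃ N : ℕ, ∀ k, N ≤ k →
      ∀ (hr : SpherePoly.mk s (sectorialRe k) ∈ C) (hi : SpherePoly.mk s (sectorialIm k) ∈ C),
        Q.op ⟨_, hr⟩ = 0 ∧ Q.op ⟨_, hi⟩ = 0 := by
  set S := Q.op ⟨spin s 2, hC (spin_mem_P1 2)⟩ with hS
  let T : Module.End ℂ (Module.End ℂ Q.domain) := LinearMap.mulLeft ℂ S - LinearMap.mulRight ℂ S
  obtain ⟨R, hR⟩ := T.finite_hasEigenvalue.isBounded.exists_norm_le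
  obtain ⟨N, hN⟩ := exists_nat_gt R
  refine ⟨N, fun k hk hr hi => ?_⟩
  have hzero : ∀ (μ : ℂ), ‖μ‖ = k → ∀ X, T X = μ • X → X = 0 := by
    intro μ hμ X hX
    by_contra h0
    have h1 := hR μ (Module.End.hasEigenvalue_of_hasEigenvector
      ⟨Module.End.mem_eigenspace_iff.2 hX, h0⟩)
    have h2 : (N : ℝ) ≤ k := by exact_mod_cast hk
    linarith
  set A := Q.op ⟨_, hr⟩ with hA
  set B := Q.op ⟨_, hi⟩ with hB
  have hsmul : ∀ (c : ℝ) (X : Module.End ℂ Q.domain), c • X = (c : ℂ) • X := fun c X =>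
    LinearMap.ext fun v => (Complex.coe_smul c (X v)).symm
  have hTA : T A = (Complex.I * k) • B := by
    have h1 : (⁅(⟨spin s 2, hC (spin_mem_P1 2)⟩ : C), ⟨_, hr⟩⁆ : C) = (k : ℝ) • ⟨_, hi⟩ :=
      Subtype.ext (by
        change SpherePoly.mk s (spinBracket (X 2) (sectorialRe k)) = (k : ℝ) • SpherePoly.mk s (sectorialIm k)
        rw [(spinBracket_X_two_sectorial k).1, map_smul])
    have h2 := Q.op_mul_op ⟨spin s 2, hC (spin_mem_P1 2)⟩ ⟨_, hr⟩
    rw [h1, map_smul, hsmul, smul_smul] at h2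
    exact sub_eq_iff_eq_add'.2 h2
  have hTB : T B = -(Complex.I * k) • A := by
    have h1 : (⁅(⟨spin s 2, hC (spin_mem_P1 2)⟩ : C), ⟨_, hi⟩⁆ : C) = -(k : ℝ) • ⟨_, hr⟩ :=
      Subtype.ext (by
        change SpherePoly.mk s (spinBracket (X 2) (sectorialIm k)) = -(k : ℝ) • SpherePoly.mk s (sectorialRe k)
        rw [(spinBracket_X_two_sectorial k).2, map_smul])
    have h2 := Q.op_mul_op ⟨spin s 2, hC (spin_mem_P1 2)⟩ ⟨_, hi⟩
    rw [h1, map_smul, hsmul, smul_smul, Complex.ofReal_neg, mul_neg] at h2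
    exact sub_eq_iff_eq_add'.2 h2
  have hI : Complex.I * (Complex.I * k) = -k := by rw [← mul_assoc, Complex.I_mul_I, neg_one_mul]
  have h1 : A + Complex.I • B = 0 := hzero k (by simp) _ (by
    rw [map_add, map_smul, hTA, hTB, smul_smul, mul_neg, hI, neg_neg]
    module)
  have h2 : A - Complex.I • B = 0 := hzero (-k) (by simp) _ (by
    rw [map_sub, map_smul, hTA, hTB, smul_smul, mul_neg, hI, neg_neg]
    module)
  have hA0 : A = 0 := by
    have h3 : (2 : ℂ) • A = 0 := by
      rw [show (2 : ℂ) • A = (A + Complex.I • B) + (A - Complex.I • B) by module, h1, h2, add_zero]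
    exact (smul_eq_zero.1 h3).resolve_left two_ne_zero
  refine ⟨hA0, ?_⟩
  rw [hA0, zero_add] at h1
  exact (smul_eq_zero.1 h1).resolve_left Complex.I_ne_zero

/-- The kernel is a Lie ideal. High sectorial functions put a function S₃(S₁² + S₂²)ᵐ into it, the
Casimir descent puts S₃ into it, and the commutation relations then kill S₁ and S₂. -/
theorem op_spin_eq_zero (hs : 0 < s) (Q : Quantization C H) (hC : P1 s < C)
    (hirr : Q.IsIrreducibleOn (P1 s)) (i : Fin 3) :
    Q.op ⟨spin s i, hC.le (spin_mem_P1 i)⟩ = 0 := by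
  have := Q.finiteDimensional_domain hC.le hirr
  obtain ⟨N, hN⟩ := Q.exists_op_sectorial_eq_zero hC.le
  obtain ⟨k, hk, hr, hi⟩ := exists_le_sectorial_mem hC N
  obtain ⟨hA, hB⟩ := hN k (by omega) hr hi
  let K : Submodule ℝ (SpherePoly s) := (LinearMap.ker Q.op).map C.toSubmodule.subtype
  have hlie : ∀ {f g : C}, Q.op g = 0 → Q.op ⁅f, g⁆ = 0 := fun {f g} hg => by
    rw [Q.op_bracket, hg, mul_zero, zero_mul, sub_zero, smul_zero]
  have hK : ∀ i, ∀ f ∈ K, ⁅spin s i, f⁆ ∈ K := by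
    rintro i _ ⟨f, hf, rfl⟩
    exact ⟨⁅⟨spin s i, hC.le (spin_mem_P1 i)⟩, f⁆, hlie hf, rfl⟩
  obtain ⟨m, rfl⟩ : ∃ m, k = m + 1 := ⟨k - 1, by omega⟩
  have hmem : SpherePoly.mk s (X 2 * (X 0 ^ 2 + X 1 ^ 2) ^ m) ∈ K := by
    have hne : ((m : ℝ) + 1) ^ 2 ≠ 0 := by positivity
    refine (K.smul_mem_iff hne).1 ?_
    rw [← map_smul, ← spinBracket_sectorialRe_sectorialIm]
    exact ⟨⁅⟨_, hr⟩, ⟨_, hi⟩⁆, hlie hB, rfl⟩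
  obtain ⟨f, hf, hf2⟩ := spin_two_mem_of_mul_pow_mem hs hK hmem
  obtain rfl : f = ⟨spin s 2, hC.le (spin_mem_P1 2)⟩ := Subtype.ext hf2
  have h2 : Q.op ⟨spin s 2, hC.le (spin_mem_P1 2)⟩ = 0 := hf
  have ht := Q.isSpinTriple hC.le
  have h0 : Q.op ⟨spin s 0, hC.le (spin_mem_P1 0)⟩ = 0 := by
    have := ht.comm₂₃
    rw [h2, mul_zero, zero_mul, zero_add] at this
    exact (smul_eq_zero.1 this.symm).resolve_left Complex.I_ne_zero
  have h1 : Q.op ⟨spin s 1, hC.le (spin_mem_P1 1)⟩ = 0 := by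
    have := ht.comm₃₁
    rw [h2, mul_zero, zero_mul, zero_add] at this
    exact (smul_eq_zero.1 this.symm).resolve_left Complex.I_ne_zero
  fin_cases i
  exacts [h0, h1, h2]

/-- The extension may live on a smaller domain, so Q(Sᵢ) is known to vanish only there. That domain
is dense, and symmetry of Q(Sᵢ) spreads the vanishing to the whole domain of Q. -/
theorem not_isNontrivial_of_extends (hs : 0 < s) (Q : Quantization (P1 s) H)
    (Q' : Quantization C H) (hC : P1 s < C) (hirr : Q'.IsIrreducibleOn (P1 s))
    (hext : Q'.Extends Q) : ¬ Q.IsNontrivial := by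
  rintro ⟨i, hi, hne⟩
  obtain ⟨hC', hD, hval⟩ := hext
  refine hne (LinearMap.ext fun v => Subtype.ext ?_)
  refine Q'.dense_domain.eq_zero_of_inner_left ℂ fun w hw => ?_
  have h1 := Q.isSymmetric_op ⟨spin s i, hi⟩ v ⟨w, hD hw⟩
  have h2 := hval ⟨spin s i, hi⟩ ⟨w, hw⟩
  rw [Q'.op_spin_eq_zero hs hC hirr i] at h2
  have h3 : Q.op ⟨spin s i, hi⟩ ⟨w, hD hw⟩ = 0 := Subtype.ext h2.symm
  rw [h3, inner_zero_right] at h1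
  exact h1

end Quantization

/-! ### The spin one half quantization -/

theorem isSelfAdjoint_closure_operatorOn_top {H : Type*} [NormedAddCommGroup H]
    [InnerProductSpace ℂ H] [CompleteSpace H] {T : Module.End ℂ (⊤ : Submodule ℂ H)}
    (hT : T.IsSymmetric) : IsSelfAdjoint (operatorOn T).closure := by
  set A := operatorOn T with hA
  have hdom : A.domain = ⊤ := rfl
  have hdense : Dense (A.domain : Set H) := by rw [hdom]; exact dense_univ
  have hform : A.IsFormalAdjoint A := fun x y => hT x y
  have hadj : A = A.adjoint := LinearPMap.eq_of_le_of_domain_eq (hform.le_adjoint hdense)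
    (top_le_iff.1 (hform.le_adjoint hdense).1).symm
  have hcl : A = A.closure := LinearPMap.eq_of_le_of_domain_eq A.le_closure
    (top_le_iff.1 A.le_closure.1).symm
  rw [← hcl]
  exact hadj.symm

namespace SpherePoly

open MvPolynomial

/-- Evaluation at a point of the sphere. -/
noncomputable def evalAt {s : ℝ} (x : Fin 3 → ℝ) (hx : x 0 ^ 2 + x 1 ^ 2 + x 2 ^ 2 = s ^ 2) :
    SpherePoly s →ₗ[ℝ] ℝ :=
  (Ideal.Quotient.liftₐ (sphereIdeal s) (aeval x) fun p hp => by
    obtain ⟨a, rfl⟩ := Ideal.mem_span_singleton'.1 hp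
    simp [sphereRelation, hx]).toLinearMap

theorem evalAt_mk {s : ℝ} (x : Fin 3 → ℝ) (hx : x 0 ^ 2 + x 1 ^ 2 + x 2 ^ 2 = s ^ 2)
    (p : MvPolynomial (Fin 3) ℝ) : evalAt x hx (mk s p) = aeval x p := rfl

/-- Evaluation at the point of the sphere on a positive or negative coordinate axis. -/
noncomputable def evalPole (s : ℝ) (ε : ℤˣ) (i : Fin 3) : SpherePoly s →ₗ[ℝ] ℝ :=
  evalAt (Pi.single i (((ε : ℤ) : ℝ) * s)) (by
    have h : (((ε : ℤ) : ℝ)) ^ 2 = 1 := by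
      rcases Int.units_eq_one_or ε with rfl | rfl <;> simp
    fin_cases i <;> simp [mul_pow, h])

/-- The quantization map of spin one half, `c + ∑ aᵢ Sᵢ ↦ c + ∑ aᵢ σᵢ / 2`. -/
noncomputable def spinHalf (s : ℝ) : SpherePoly s →ₗ[ℝ] Matrix (Fin 2) (Fin 2) ℂ :=
  ((2⁻¹ : ℝ) • (evalPole s 1 0 + evalPole s (-1) 0)).smulRight 1 +
    ((2 * s)⁻¹ • (evalPole s 1 0 - evalPole s (-1) 0)).smulRight !![0, 1 / 2; 1 / 2, 0] +
    ((2 * s)⁻¹ • (evalPole s 1 1 - evalPole s (-1) 1)).smulRight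
      !![0, -Complex.I / 2; Complex.I / 2, 0] +
    ((2 * s)⁻¹ • (evalPole s 1 2 - evalPole s (-1) 2)).smulRight !![1 / 2, 0; 0, -1 / 2]

/-- Values at the poles recover the coefficients: the even part along an axis gives c, the odd part
gives s·aᵢ. Well-definedness on the quotient therefore comes for free. -/
theorem spinHalf_mk {s : ℝ} (hs : 0 < s) (c a₀ a₁ a₂ : ℝ) :
    spinHalf s (mk s (C c + C a₀ * X 0 + C a₁ * X 1 + C a₂ * X 2)) =
      !![(c : ℂ) + a₂ / 2, (a₀ - Complex.I * a₁) / 2; (a₀ + Complex.I * a₁) / 2, c - a₂ / 2] := by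
  have hs' : (s : ℂ) ≠ 0 := by exact_mod_cast hs.ne'
  ext i j
  fin_cases i <;> fin_cases j <;>
    simp [spinHalf, evalPole, evalAt_mk] <;> field_simp <;> ring

theorem exists_coords_of_mem_P1 {s : ℝ} {f : SpherePoly s} (hf : f ∈ P1 s) :
    ∃ c a₀ a₁ a₂ : ℝ, f = mk s (C c + C a₀ * X 0 + C a₁ * X 1 + C a₂ * X 2) := by
  obtain ⟨p, hp, rfl⟩ := hf
  obtain ⟨c, a, h⟩ := exists_mk_eq_of_degree_le_one (s := s) hp
  refine ⟨c, a 0, a 1, a 2, h.trans ?_⟩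
  simp only [map_add, mk_C, ← MvPolynomial.smul_eq_C_mul, map_smul, Fin.sum_univ_three, spin,
    add_assoc]

theorem spinHalf_lie {s : ℝ} (hs : 0 < s) {f g : SpherePoly s} (hf : f ∈ P1 s) (hg : g ∈ P1 s) :
    spinHalf s ⁅f, g⁆ =
      (-Complex.I) • (spinHalf s f * spinHalf s g - spinHalf s g * spinHalf s f) := by
  obtain ⟨c, a₀, a₁, a₂, rfl⟩ := exists_coords_of_mem_P1 hf
  obtain ⟨d, b₀, b₁, b₂, rfl⟩ := exists_coords_of_mem_P1 hg
  have h1 : spinBracket (C c + C a₀ * X 0 + C a₁ * X 1 + C a₂ * X 2)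
      (C d + C b₀ * X 0 + C b₁ * X 1 + C b₂ * X 2) =
      C 0 + C (a₁ * b₂ - a₂ * b₁) * X 0 + C (a₂ * b₀ - a₀ * b₂) * X 1 +
        C (a₀ * b₁ - a₁ * b₀) * X 2 := by
    simp only [spinBracket, map_add, pderiv_C, pderiv_C_mul, pderiv_X, map_sub, map_mul, map_zero]
    simp
    ring
  rw [mk_lie_mk, h1, spinHalf_mk hs, spinHalf_mk hs, spinHalf_mk hs]
  ext i j
  fin_cases i <;> fin_cases j <;> simp <;> ring_nf <;>
    simp [Complex.I_sq] <;> ring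

theorem isHermitian_spinHalf {s : ℝ} (hs : 0 < s) {f : SpherePoly s} (hf : f ∈ P1 s) :
    (spinHalf s f).IsHermitian := by
  obtain ⟨c, a₀, a₁, a₂, rfl⟩ := exists_coords_of_mem_P1 hf
  rw [spinHalf_mk hs]
  ext i j
  fin_cases i <;> fin_cases j <;> simp [Matrix.conjTranspose_apply]
  all_goals ring

end SpherePoly

/-- Matrices as operators on the (improper) subspace `⊤` of `ℂ²`. -/
noncomputable def spinorRep : Matrix (Fin 2) (Fin 2) ℂ ≃ₐ[ℂ]
    Module.End ℂ (⊤ : Submodule ℂ (EuclideanSpace ℂ (ULift.{u} (Fin 2)))) :=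
  (Matrix.reindexAlgEquiv ℂ ℂ Equiv.ulift.{u}.symm).trans <|
    Matrix.toLinAlgEquiv'.trans <|
      ((WithLp.linearEquiv 2 ℂ (ULift.{u} (Fin 2) → ℂ)).symm.conjAlgEquiv ℂ).trans
        (Submodule.topEquiv.symm.conjAlgEquiv ℂ)

theorem spinorRep_apply (M : Matrix (Fin 2) (Fin 2) ℂ)
    (v : (⊤ : Submodule ℂ (EuclideanSpace ℂ (ULift.{u} (Fin 2))))) (i : ULift.{u} (Fin 2)) :
    (spinorRep M v : EuclideanSpace ℂ (ULift.{u} (Fin 2))) i =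
      M i.down 0 * v.1 ⟨0⟩ + M i.down 1 * v.1 ⟨1⟩ := by
  change ((Matrix.reindexAlgEquiv ℂ ℂ Equiv.ulift.{u}.symm M).mulVec (WithLp.ofLp v.1)) i = _
  rw [Matrix.mulVec, dotProduct, ← Equiv.ulift.{u}.symm.sum_comp, Fin.sum_univ_two]
  rfl

theorem isSymmetric_spinorRep {M : Matrix (Fin 2) (Fin 2) ℂ} (hM : M.IsHermitian) :
    LinearMap.IsSymmetric (𝕜 := ℂ)
      (E := (⊤ : Submodule ℂ (EuclideanSpace ℂ (ULift.{u} (Fin 2))))) (spinorRep.{u} M) := by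
  have h1 : (Matrix.reindexAlgEquiv ℂ ℂ Equiv.ulift.{u}.symm M).IsHermitian :=
    hM.submatrix _
  exact fun v w => Matrix.isSymmetric_toEuclideanLin_iff.2 h1 v.1 w.1

open SpherePoly

/-- The spin one half quantization of `𝒫¹`. -/
noncomputable def spinHalfQuantization {s : ℝ} (hs : 0 < s) :
    Quantization (P1 s) (EuclideanSpace ℂ (ULift.{u} (Fin 2))) where
  domain := ⊤
  dense_domain := dense_univ
  op := (spinorRep.{u}.toLinearMap.restrictScalars ℝ) ∘ₗ spinHalf s ∘ₗ (P1 s).toSubmodule.subtype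
  essentially_selfAdjoint f := isSelfAdjoint_closure_operatorOn_top
    (isSymmetric_spinorRep (isHermitian_spinHalf hs f.2))
  op_bracket f g := by
    change spinorRep (spinHalf s ⁅(f : SpherePoly s), (g : SpherePoly s)⁆) =
      (-Complex.I) • (spinorRep (spinHalf s f) * spinorRep (spinHalf s g) -
        spinorRep (spinHalf s g) * spinorRep (spinHalf s f))
    rw [spinHalf_lie hs f.2 g.2, map_smul, map_sub, map_mul, map_mul]
  op_one h := by
    change spinorRep (spinHalf s 1) = 1
    have h1 : (1 : SpherePoly s) =
        mk s (MvPolynomial.C 1 + MvPolynomial.C 0 * MvPolynomial.X 0 +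
          MvPolynomial.C 0 * MvPolynomial.X 1 + MvPolynomial.C 0 * MvPolynomial.X 2) := by
      simp
      rfl
    rw [h1, spinHalf_mk hs, ← map_one spinorRep.{u}]
    congr 1
    ext i j
    fin_cases i <;> fin_cases j <;> simp

theorem spinHalfQuantization_op_apply {s : ℝ} (hs : 0 < s) (f : P1 s)
    (v : EuclideanSpace ℂ (ULift.{u} (Fin 2))) (i : ULift.{u} (Fin 2)) :
    ((spinHalfQuantization.{u} hs).op f ⟨v, Submodule.mem_top⟩ :
        EuclideanSpace ℂ (ULift.{u} (Fin 2))) i =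
      spinHalf s f i.down 0 * v ⟨0⟩ + spinHalf s f i.down 1 * v ⟨1⟩ :=
  spinorRep_apply _ ⟨v, Submodule.mem_top⟩ i

theorem spinHalf_spin {s : ℝ} (hs : 0 < s) :
    spinHalf s (spin s 0) = !![0, 1 / 2; 1 / 2, 0] ∧
    spinHalf s (spin s 1) = !![0, -Complex.I / 2; Complex.I / 2, 0] ∧
    spinHalf s (spin s 2) = !![1 / 2, 0; 0, -1 / 2] := by
  have h0 := spinHalf_mk hs 0 1 0 0
  have h1 := spinHalf_mk hs 0 0 1 0
  have h2 := spinHalf_mk hs 0 0 0 1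
  simp at h0 h1 h2
  refine ⟨h0.trans ?_, h1.trans ?_, h2.trans ?_⟩ <;> ext i j <;> fin_cases i <;> fin_cases j <;>
    simp <;> ring

/-- S₁ ± iS₂ are the off-diagonal matrix units, so a nonzero invariant subspace contains both basis
vectors. -/
theorem spinHalfQuantization_isAdmissible {s : ℝ} (hs : 0 < s) :
    (spinHalfQuantization.{u} hs).IsAdmissible (P1 s) := by
  refine ⟨le_rfl, inferInstance, fun W _ hW => ?_⟩
  refine or_iff_not_imp_left.2 fun hne => ?_
  obtain ⟨h0, h1, -⟩ := spinHalf_spin hs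
  have hE : ∀ v ∈ W, EuclideanSpace.single ⟨0⟩ (v ⟨1⟩) ∈ W := by
    intro v hv
    have m0 := hW ⟨_, spin_mem_P1 0⟩ (spin_mem_P1 0) ⟨v, Submodule.mem_top⟩ hv
    have m1 := hW ⟨_, spin_mem_P1 1⟩ (spin_mem_P1 1) ⟨v, Submodule.mem_top⟩ hv
    convert W.add_mem m0 (W.smul_mem Complex.I m1) using 1
    ext ⟨i⟩
    rw [PiLp.add_apply, PiLp.smul_apply, spinHalfQuantization_op_apply,
      spinHalfQuantization_op_apply, h0, h1]
    fin_cases i <;> simp <;> ring_nf <;> simp [Complex.I_sq] <;> ring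
  have hF : ∀ v ∈ W, EuclideanSpace.single ⟨1⟩ (v ⟨0⟩) ∈ W := by
    intro v hv
    have m0 := hW ⟨_, spin_mem_P1 0⟩ (spin_mem_P1 0) ⟨v, Submodule.mem_top⟩ hv
    have m1 := hW ⟨_, spin_mem_P1 1⟩ (spin_mem_P1 1) ⟨v, Submodule.mem_top⟩ hv
    convert W.sub_mem m0 (W.smul_mem Complex.I m1) using 1
    ext ⟨i⟩
    rw [PiLp.sub_apply, PiLp.smul_apply, spinHalfQuantization_op_apply,
      spinHalfQuantization_op_apply, h0, h1]
    fin_cases i <;> simp <;> ring_nf <;> simp [Complex.I_sq] <;> ring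
  have hscale : ∀ (i : ULift.{u} (Fin 2)) {c : ℂ}, c ≠ 0 → EuclideanSpace.single i c ∈ W →
      ∀ d : ℂ, EuclideanSpace.single i d ∈ W := by
    intro i c hc hi d
    have : EuclideanSpace.single i d = (d / c) • EuclideanSpace.single i c := by
      ext j
      by_cases hj : j = i
      · subst hj; simp [hc]
      · simp [hj]
    rw [this]
    exact W.smul_mem _ hi
  have hboth : (∀ d, EuclideanSpace.single ⟨0⟩ d ∈ W) ∧ (∀ d, EuclideanSpace.single ⟨1⟩ d ∈ W) := by
    obtain ⟨v, hv, hv0⟩ := W.exists_mem_ne_zero_of_ne_bot hne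
    have hEF : (∀ d, EuclideanSpace.single (⟨0⟩ : ULift.{u} (Fin 2)) d ∈ W) →
        ∀ d, EuclideanSpace.single (⟨1⟩ : ULift.{u} (Fin 2)) d ∈ W := fun h d => by
      simpa using hF _ (h d)
    have hFE : (∀ d, EuclideanSpace.single (⟨1⟩ : ULift.{u} (Fin 2)) d ∈ W) →
        ∀ d, EuclideanSpace.single (⟨0⟩ : ULift.{u} (Fin 2)) d ∈ W := fun h d => by
      simpa using hE _ (h d)
    by_cases hv1 : v ⟨1⟩ = 0
    · by_cases hv2 : v ⟨0⟩ = 0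
      · refine absurd ?_ hv0
        ext ⟨i⟩
        fin_cases i
        exacts [hv2, hv1]
      · have h := hscale _ hv2 (hF v hv)
        exact ⟨hFE h, h⟩
    · have h := hscale _ hv1 (hE v hv)
      exact ⟨h, hEF h⟩
  have htop : W = ⊤ := by
    refine Submodule.eq_top_iff'.2 fun v => ?_
    have : v = EuclideanSpace.single ⟨0⟩ (v ⟨0⟩) + EuclideanSpace.single ⟨1⟩ (v ⟨1⟩) := by
      ext ⟨i⟩
      fin_cases i <;> simp
    rw [this]
    exact W.add_mem (hboth.1 _) (hboth.2 _)
  rw [htop]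
  exact dense_univ

theorem spinHalfQuantization_isNontrivial {s : ℝ} (hs : 0 < s) :
    (spinHalfQuantization.{u} hs).IsNontrivial := by
  refine ⟨2, spin_mem_P1 2, fun h => ?_⟩
  have h1 := spinHalfQuantization_op_apply.{u} hs ⟨_, spin_mem_P1 2⟩
    (EuclideanSpace.single ⟨0⟩ 1) ⟨0⟩
  rw [(spinHalf_spin hs).2.2, h] at h1
  simp at h1

theorem theorem3 (s : ℝ) (hs : 0 < s) :
    (∀ (H : Type u) [NormedAddCommGroup H] [InnerProductSpace ℂ H] [CompleteSpace H]
        (Q : Quantization (SpherePoly.P1 s) H),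
        Q.IsNontrivial →
        ∀ C : LieSubalgebra ℝ (SpherePoly s), SpherePoly.P1 s < C →
          ¬ ∃ Q' : Quantization C H, Q'.IsAdmissible (SpherePoly.P1 s) ∧ Q'.Extends Q) ∧
      IsGreatest
        {C : LieSubalgebra ℝ (SpherePoly s) |
          1 ∈ C ∧ (∀ i : Fin 3, SpherePoly.spin s i ∈ C) ∧
            AdmitsNontrivialAdmissibleQuantization.{u} C}
        (SpherePoly.P1 s) := by
  refine ⟨fun H _ _ _ Q hQ C hC ⟨Q', hadm, hext⟩ =>
    Q.not_isNontrivial_of_extends hs Q' hC hadm.2 hext hQ,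
    ⟨one_mem_P1, spin_mem_P1, _, _, _, _, spinHalfQuantization.{u} hs,
      spinHalfQuantization_isAdmissible hs, spinHalfQuantization_isNontrivial hs⟩, ?_⟩
  rintro C ⟨-, -, H, _, _, _, Q, ⟨hle, hirr⟩, i, hi, hne⟩
  by_contra hC
  exact hne (Q.op_spin_eq_zero hs (lt_of_le_not_ge hle hC) hirr i)
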